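/- Consider the parametric mathematical program with complementarity constraints (MPCC) $$\min_{w\in\mathbb R^n} f(w,p)\quad\text{s.t.}\quad h(w,p)=0,\quad g(w,p)\le 0,\quad 0\le G(w,p)\perp H(w,p)\ge 0,$$ with $p\in\mathbb R^{n_p}$ and $f,h,g,G,H$ twice continuously differentiable in $(w,p)$, with values in $\mathbb R,\mathbb R^{m_h},\mathbb R^{m_g},\mathbb R^m,\mathbb R^m$. For feasible $w$ let $\mathcal I_{0+}(w),\mathcal I_{+0}(w),\mathcal I_{00}(w)$ be the sets of indices $i$ with $G_i=0<H_i$, $G_i>0=H_i$, $G_i=H_i=0$ (the last ones are called degenerate), and $\mathcal P(w,p)=\{\mathcal I_{0+}(w)\cup\mathcal J:\mathcal J\subseteq\mathcal I_{00}(w)\}$. For $\mathcal I\subseteq\{1,\dots,m\}$ the branch problem $\mathrm{BNLP}_{\mathcal I}(p)$ replaces the complementarity constraints by $G_i=0,\ H_i\ge0$ $(i\in\mathcal I)$ and $G_i\ge0,\ H_i=0$ $(i\notin\mathcal I)$; its Lagrangian is $\mathcal L=f+\lambda^\top h+\mu^\top g-\xi^\top G-\nu^\top H$, and $z=(w,\lambda,\mu,\xi,\nu)$.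 A feasible $w$ is B-stationary if it is a KKT point of $\mathrm{BNLP}_{\mathcal I}(p)$ for every $\mathcal I\in\mathcal P(w,p)$; $z$ is S-stationary if it satisfies the KKT conditions of the relaxed problem, i.e. $w$ is feasible, $\nabla_w\mathcal L=0$, $0\le\mu\perp -g\ge 0$, $\nu_i=0$ on $\mathcal I_{0+}$, $\xi_i=0$ on $\mathcal I_{+0}$, and $\xi_i,\nu_i\ge0$ on $\mathcal I_{00}$. MPCC-LICQ is linear independence of the $w$-gradients of all $h_i$ and of all those $g_i,G_i,H_i$ that vanish at the point. MPCC-SSOSC at $w$ means that there are multipliers making $z$ S-stationary with $d^\top\nabla^2_{ww}\mathcal L\,d>0$ for all $d\ne0$ in the union over $\mathcal I\in\mathcal P(w,p)$ of the strong critical cones of $\mathrm{BNLP}_{\mathcal I}(p)$ (the tangent space of the equality constraints and of the active inequality constraints with positive multiplier). A map is $\mathrm{PC}^1$ near a point if on a neighborhood of it the map is continuous and a selection of finitely many $C^1$ maps. Let $\bar w$ be B-stationary for $\bar p$, with MPCC-LICQ and MPCC-SSOSC at $(\bar w,\bar p)$. Let $v\in\mathbb R^{n_p}$, $p(\tau)=\bar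 p+\tau v$ and $\mathcal S_T=\{p(\tau):\tau\in[0,T]\}$. Let $\mathcal I\in\mathcal P(\bar w,\bar p)$, and let $z^{\mathcal I}=(w^{\mathcal I},\lambda^{\mathcal I},\mu^{\mathcal I},\xi^{\mathcal I},\nu^{\mathcal I})$ be a solution map of $\mathrm{BNLP}_{\mathcal I}$ with $w^{\mathcal I}(\bar p)=\bar w$ on an open set $U\supseteq\mathcal S_1$, i.e. $z^{\mathcal I}$ is continuous on $U$ and, for each $p\in U$, $z^{\mathcal I}(p)$ is a KKT point of $\mathrm{BNLP}_{\mathcal I}(p)$ at which LICQ and SSOSC of this problem hold. Let either $i\in\mathcal I_{0+}(\bar w)$ and $\theta=\xi_i^{\mathcal I}$, or $i\in\mathcal I_{+0}(\bar w)$ and $\theta=\nu_i^{\mathcal I}$. Suppose that this index becomes degenerate at $\tau_s\in(0,1)$: $i\notin\mathcal I_{00}(w^{\mathcal I}(p(\tau)))$ for $\tau\in[0,\tau_s)$ and $i\in\mathcal I_{00}(w^{\mathcal I}(p(\tau)))$ for $\tau\in[\tau_s,1]$; put $p_s=p(\tau_s)$. Say that no other pair interferes at $p$ if $\xi^{\mathcal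 I}_j(p),\nu^{\mathcal I}_j(p)\ge0$ for all $j\ne i$ with $j\in\mathcal I_{00}(w^{\mathcal I}(p))$ (for instance, if all pairs $j\neq i$ are nondegenerate). Then: (a) If no other pair interferes on $\mathcal S_1$ and $\theta(p(\tau))\ge0$ for all $\tau\in[\tau_s,1]$, then $z^{\mathcal I}$ is $\mathrm{PC}^1$ near every $p\in\mathcal S_1$, and $w^{\mathcal I}(p)$ is B-stationary for every $p\in\mathcal S_1$. (b) If $\theta(p_s)<0$, then $w^{\mathcal I}(p(\tau))$ is not B-stationary for any $\tau\in[\tau_s,1]$ with $\theta(p(\tau))<0$; in particular, for all $T>\tau_s$ sufficiently close to $\tau_s$, it is not B-stationary for any $\tau\in[\tau_s,T]$. Moreover, if no other pair interferes at $p(\tau)$ for $\tau\in[0,\tau_s)$, and if $\hat w$ is a B-stationary point for $p_s$ satisfying MPCC-LICQ and MPCC-SSOSC, then for all $T>\tau_s$ sufficiently close to $\tau_s$ there is a map $z(\cdot)=(w,\lambda,\mu,\xi,\nu)(\cdot)$ on $\mathcal S_T$ such that $w(p)$ is B-stationary and $z(p)$ is S-stationary for every $p\in\mathcal S_T$, $z=z^{\mathcal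 I}$ at $p(\tau)$ for $\tau\in[0,\tau_s)$, $w(p_s)=\hat w$, and both $z$ and $w$ are discontinuous at $p_s$. If no other pair interferes on $\mathcal S_1$ and $\theta(p_s)\ne0$, then for all $T>\tau_s$ sufficiently close to $\tau_s$ exactly one of the following occurs: $z^{\mathcal I}$ is $\mathrm{PC}^1$ near, and $w^{\mathcal I}$ is B-stationary at, every point of $\mathcal S_T$; or $w^{\mathcal I}(p(\tau))$ is not B-stationary for any $\tau\in[\tau_s,T]$. -/

import Mathlib

open Set Filter Topology

/-- `ℝⁿ` with the Euclidean norm. -/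
abbrev Vec (n : ℕ) := EuclideanSpace ℝ (Fin n)

/-- Primal-dual vectors `z = (w, λ, μ, ξ, ν)`. -/
abbrev PrimalDual (n mh mg m : ℕ) := Vec n × Vec mh × Vec mg × Vec m × Vec m

namespace PrimalDual

variable {n mh mg m : ℕ}

/-- The primal component `w`. -/
def w (z : PrimalDual n mh mg m) : Vec n := z.1

/-- The multiplier `λ` of `h(w,p) = 0`. -/
def lam (z : PrimalDual n mh mg m) : Vec mh := z.2.1

/-- The multiplier `μ` of `g(w,p) ≤ 0`. -/
def mu (z : PrimalDual n mh mg m) : Vec mg := z.2.2.1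

/-- The multiplier `ξ` belonging to `G`. -/
def xi (z : PrimalDual n mh mg m) : Vec m := z.2.2.2.1

/-- The multiplier `ν` belonging to `H`. -/
def nu (z : PrimalDual n mh mg m) : Vec m := z.2.2.2.2

end PrimalDual

/-- A parametric mathematical program with complementarity constraints
`min_w f(w,p)  s.t.  h(w,p) = 0,  g(w,p) ≤ 0,  0 ≤ G(w,p) ⟂ H(w,p) ≥ 0`
with twice continuously differentiable data (the variable is the pair `(w, p)`). -/
structure ParamMPCC (n np mh mg m : ℕ) where
  f : Vec n × Vec np → ℝ
  h : Fin mh → Vec n × Vec np → ℝ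
  g : Fin mg → Vec n × Vec np → ℝ
  G : Fin m → Vec n × Vec np → ℝ
  H : Fin m → Vec n × Vec np → ℝ
  contDiff_f : ContDiff ℝ 2 f
  contDiff_h : ∀ i, ContDiff ℝ 2 (h i)
  contDiff_g : ∀ i, ContDiff ℝ 2 (g i)
  contDiff_G : ∀ i, ContDiff ℝ 2 (G i)
  contDiff_H : ∀ i, ContDiff ℝ 2 (H i)

namespace ParamMPCC

variable {n np mh mg m : ℕ} (Q : ParamMPCC n np mh mg m)

/-- The feasible set for the parameter `p`. -/
def Feasible (w : Vec n) (p : Vec np) : Prop :=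
  (∀ i, Q.h i (w, p) = 0) ∧ (∀ i, Q.g i (w, p) ≤ 0) ∧
    ∀ i, 0 ≤ Q.G i (w, p) ∧ 0 ≤ Q.H i (w, p) ∧ Q.G i (w, p) * Q.H i (w, p) = 0

/-- The index set `𝓘₀₊`. -/
def I0p (w : Vec n) (p : Vec np) : Set (Fin m) := {i | Q.G i (w, p) = 0 ∧ 0 < Q.H i (w, p)}

/-- The index set `𝓘₊₀`. -/
def Ip0 (w : Vec n) (p : Vec np) : Set (Fin m) := {i | 0 < Q.G i (w, p) ∧ Q.H i (w, p) = 0}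

/-- The degenerate indices `𝓘₀₀`. -/
def I00 (w : Vec n) (p : Vec np) : Set (Fin m) := {i | Q.G i (w, p) = 0 ∧ Q.H i (w, p) = 0}

/-- The active inequality constraints `𝓐`. -/
def active (w : Vec n) (p : Vec np) : Set (Fin mg) := {i | Q.g i (w, p) = 0}

/-- The family `𝓟(w, p)` of branch index sets `𝓘 = 𝓘₀₊ ∪ 𝓘'` with `𝓘' ⊆ 𝓘₀₀`. -/
def branches (w : Vec n) (p : Vec np) : Set (Set (Fin m)) :=
  {I | ∃ J ⊆ Q.I00 w p, I = Q.I0p w p ∪ J}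

/-- The partial derivative `∇_w φ(w,p)`, as a linear form on `ℝⁿ`. -/
noncomputable def dw (φ : Vec n × Vec np → ℝ) (w : Vec n) (p : Vec np) : Vec n →L[ℝ] ℝ :=
  fderiv ℝ (fun x => φ (x, p)) w

/-- The MPCC Lagrangian as a function of `w`; the multipliers are those of `z`. -/
noncomputable def lagrangian (z : PrimalDual n mh mg m) (p : Vec np) (w : Vec n) : ℝ :=
  Q.f (w, p) + ∑ i, z.lam i * Q.h i (w, p) + ∑ i, z.mu i * Q.g i (w, p)
    - ∑ i, z.xi i * Q.G i (w, p) - ∑ i, z.nu i * Q.H i (w, p)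

/-- The quadratic form `dᵀ ∇²_{ww} 𝓛(z,p) d`. -/
noncomputable def hessForm (z : PrimalDual n mh mg m) (p : Vec np) (d : Vec n) : ℝ :=
  fderiv ℝ (fderiv ℝ (Q.lagrangian z p)) z.w d d

/-- Linear independence of the gradients of all `h i`, of `g i` for `i ∈ A`, of `G i` for
`i ∈ K` and of `H i` for `i ∈ L`. -/
def GradientsIndependent (w : Vec n) (p : Vec np) (A : Set (Fin mg)) (K L : Set (Fin m)) : Prop :=
  LinearIndependent ℝ
    (Sum.elim (fun i : Fin mh => dw (Q.h i) w p)
      (Sum.elim (fun i : A => dw (Q.g i) w p)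
        (Sum.elim (fun i : K => dw (Q.G i) w p) (fun i : L => dw (Q.H i) w p))))

/-- MPCC-LICQ: the LICQ of the relaxed NLP at `w`. Its active constraints are `h`, the active
`g i`, `G i` for `i ∈ 𝓘₀₊ ∪ 𝓘₀₀`, and `H i` for `i ∈ 𝓘₊₀ ∪ 𝓘₀₀`. -/
def MPCCLICQ (w : Vec n) (p : Vec np) : Prop :=
  Q.GradientsIndependent w p (Q.active w p) (Q.I0p w p ∪ Q.I00 w p) (Q.Ip0 w p ∪ Q.I00 w p)

/-- `z` is a KKT point of the branch NLP
`min_w f(w,p)  s.t.  h = 0,  g ≤ 0,  G_i = 0, H_i ≥ 0 (i ∈ I),  G_i ≥ 0, H_i = 0 (i ∉ I)`. -/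
def BranchKKT (I : Set (Fin m)) (z : PrimalDual n mh mg m) (p : Vec np) : Prop :=
  fderiv ℝ (Q.lagrangian z p) z.w = 0 ∧
  (∀ i, Q.h i (z.w, p) = 0) ∧
  (∀ i, 0 ≤ z.mu i ∧ Q.g i (z.w, p) ≤ 0 ∧ z.mu i * Q.g i (z.w, p) = 0) ∧
  (∀ i ∈ I, Q.G i (z.w, p) = 0 ∧
    0 ≤ Q.H i (z.w, p) ∧ 0 ≤ z.nu i ∧ z.nu i * Q.H i (z.w, p) = 0) ∧
  (∀ i ∉ I, Q.H i (z.w, p) = 0 ∧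
    0 ≤ Q.G i (z.w, p) ∧ 0 ≤ z.xi i ∧ z.xi i * Q.G i (z.w, p) = 0)

/-- LICQ of the branch NLP `I` at `w`: besides the equality constraints `h`, `G i` (`i ∈ I`) and
`H i` (`i ∉ I`), those inequality constraints count that are active. -/
def BranchLICQ (I : Set (Fin m)) (w : Vec n) (p : Vec np) : Prop :=
  Q.GradientsIndependent w p (Q.active w p)
    (I ∪ {i | i ∉ I ∧ Q.G i (w, p) = 0}) (Iᶜ ∪ {i | i ∈ I ∧ Q.H i (w, p) = 0})

/-- The strong critical cone of the branch NLP `I` at `z`. -/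
def strongCone (I : Set (Fin m)) (z : PrimalDual n mh mg m) (p : Vec np) : Set (Vec n) :=
  {d | (∀ i, dw (Q.h i) z.w p d = 0) ∧
    (∀ i ∈ Q.active z.w p, 0 < z.mu i → dw (Q.g i) z.w p d = 0) ∧
    (∀ i, i ∈ I ∨ (i ∉ I ∧ 0 < z.xi i) → dw (Q.G i) z.w p d = 0) ∧
    (∀ i, i ∉ I ∨ (i ∈ I ∧ 0 < z.nu i) → dw (Q.H i) z.w p d = 0)}

/-- The second-order inequality of the SSOSC of the branch NLP `I` at `z`. -/
def BranchSSOSC (I : Set (Fin m)) (z : PrimalDual n mh mg m) (p : Vec np) : Prop :=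
  ∀ d ∈ Q.strongCone I z p, d ≠ 0 → 0 < Q.hessForm z p d

/-- B-stationarity: `w` is a stationary point of every branch NLP `I ∈ 𝓟(w,p)`; the
multipliers may depend on the branch. -/
def BStationary (w : Vec n) (p : Vec np) : Prop :=
  Q.Feasible w p ∧
    ∀ I ∈ Q.branches w p, ∃ z : PrimalDual n mh mg m, z.w = w ∧ Q.BranchKKT I z p

/-- S-stationarity of `z.w` with the MPCC multipliers `(λ, μ, ξ, ν)` of `z`. -/
def SStationary (z : PrimalDual n mh mg m) (p : Vec np) : Prop :=
  Q.Feasible z.w p ∧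
  fderiv ℝ (Q.lagrangian z p) z.w = 0 ∧
  (∀ i, 0 ≤ z.mu i ∧ z.mu i * Q.g i (z.w, p) = 0) ∧
  (∀ i ∈ Q.I0p z.w p, z.nu i = 0) ∧
  (∀ i ∈ Q.Ip0 z.w p, z.xi i = 0) ∧
  (∀ i ∈ Q.I00 z.w p, 0 ≤ z.xi i ∧ 0 ≤ z.nu i)

/-- The strong MPCC critical cone: the union of the strong critical cones of the branch NLPs. -/
def strongMPCCCone (z : PrimalDual n mh mg m) (p : Vec np) : Set (Vec n) :=
  ⋃ I ∈ Q.branches z.w p, Q.strongCone I z p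

/-- MPCC-SSOSC at `w`. -/
def MPCCSSOSC (w : Vec n) (p : Vec np) : Prop :=
  ∃ z : PrimalDual n mh mg m, z.w = w ∧ Q.SStationary z p ∧
    ∀ d ∈ Q.strongMPCCCone z p, d ≠ 0 → 0 < Q.hessForm z p d

/-- `z` is a solution map on `U` of the branch NLP `I`: it is continuous and each `z p` is a
KKT point of the branch NLP with parameter `p` at which LICQ and SSOSC hold (so that `(z p).w` is
an isolated local minimizer with unique multipliers). -/
def BranchSolutionMap (I : Set (Fin m)) (U : Set (Vec np))
    (z : Vec np → PrimalDual n mh mg m) : Prop :=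
  ContinuousOn z U ∧
    ∀ p ∈ U, Q.BranchKKT I (z p) p ∧ Q.BranchLICQ I (z p).w p ∧ Q.BranchSSOSC I (z p) p

/-- For all parameters `p ∈ S`, no index pair other than `i` violates the sign conditions of
S-stationarity at `z p`: every degenerate pair `j ≠ i` has nonnegative multipliers.
In particular this holds if, on `S`, all pairs `j ≠ i` are nondegenerate. -/
def OtherPairsSigned (i : Fin m) (S : Set (Vec np)) (z : Vec np → PrimalDual n mh mg m) : Prop :=
  ∀ p ∈ S, ∀ j ∈ Q.I00 (z p).w p, j ≠ i → 0 ≤ (z p).xi j ∧ 0 ≤ (z p).nu j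

end ParamMPCC

/-- `z` is piecewise continuously differentiable near `p`: on an open neighborhood of `p` it is
continuous and a selection of finitely many `C¹` functions. -/
def PC1At {E F : Type*} [NormedAddCommGroup E] [NormedSpace ℝ E] [NormedAddCommGroup F]
    [NormedSpace ℝ F] (z : E → F) (p : E) : Prop :=
  ∃ V : Set E, IsOpen V ∧ p ∈ V ∧ ContinuousOn z V ∧
    ∃ (N : ℕ) (φ : Fin N → E → F), (∀ k, ContDiffOn ℝ 1 (φ k) V) ∧ ∀ q ∈ V, ∃ k, z q = φ k q

/-- The segment `𝓢(p, p + T v) = {p + τ v : τ ∈ [0, T]}`. -/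
def paramSegment {E : Type*} [AddCommGroup E] [Module ℝ E] (p v : E) (T : ℝ) : Set E :=
  (fun τ : ℝ => p + τ • v) '' Set.Icc 0 T

/-! B-stationarity of a branch solution reduces to a sign condition. At a branch KKT point where the
gradients of the vanishing constraints are independent, the multipliers depend on `w` alone,
whatever the branch (`BranchKKT.eq_of_w_eq`). A degenerate pair may lie on either side of a branch,
and each side imposes the sign of one of its multipliers, so B-stationarity makes both nonnegative.
Conversely, these signs give S-stationarity, hence B-stationarity. Branch `I` already signs one
multiplier of the pair `i`; the other is `θ`. So once the other pairs are signed, all depends on the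
sign of `θ` from `τs` on, and by continuity a nonzero sign at `τs` persists.

Near a parameter only finitely many sets of vanishing constraints occur. Those occurring arbitrarily
close to it give a square KKT system, regular by LICQ and SSOSC, and the implicit function theorem
yields one `C¹` piece for each.

For the jump, the second-order condition makes `what` a strict local minimizer of the MPCC
(`SStationary.eventually_lt`). For nearby parameters, minimizing over a small closed ball gives an
interior minimizer, which is S-stationary by independence of the gradients
(`exists_sStationary_of_isLocalMinOn`). The jump is genuine: the left limit of `w` is not
B-stationary, while `what` is. -/

/-! ### Stationarity in terms of the joint family of constraints -/

/-- The index type of the joint constraint family `(h, g, G, H)`. -/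
abbrev ConIdx (mh mg m : ℕ) := Fin mh ⊕ Fin mg ⊕ Fin m ⊕ Fin m

namespace PrimalDual

variable {n mh mg m : ℕ}

/-- The signed multipliers `(λ, μ, -ξ, -ν)` of the joint constraint family. -/
def mult (z : PrimalDual n mh mg m) : ConIdx mh mg m → ℝ :=
  Sum.elim z.lam (Sum.elim z.mu (Sum.elim (fun i => -z.xi i) (fun i => -z.nu i)))

/-- The primal-dual vector with prescribed primal part and signed multipliers. -/
noncomputable def ofMult (x : Vec n × (ConIdx mh mg m → ℝ)) : PrimalDual n mh mg m :=
  (x.1, WithLp.toLp 2 fun i => x.2 (.inl i), WithLp.toLp 2 fun i => x.2 (.inr (.inl i)),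
    WithLp.toLp 2 fun i => -x.2 (.inr (.inr (.inl i))),
    WithLp.toLp 2 fun i => -x.2 (.inr (.inr (.inr i))))

@[simp] theorem mult_ofMult (x : Vec n × (ConIdx mh mg m → ℝ)) : (ofMult x).mult = x.2 := by
  funext k
  rcases k with i | i | i | i <;> simp [mult, ofMult, lam, mu, xi, nu]

@[simp] theorem ofMult_mult (z : PrimalDual n mh mg m) : ofMult (z.w, z.mult) = z := by
  simp [mult, ofMult, lam, mu, xi, nu, w]

theorem contDiff_ofMult : ContDiff ℝ 1 (ofMult (n := n) (mh := mh) (mg := mg) (m := m)) := by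
  unfold ofMult
  refine contDiff_fst.prodMk (ContDiff.prodMk ?_ (ContDiff.prodMk ?_ (ContDiff.prodMk ?_ ?_))) <;>
  · rw [contDiff_euclidean]
    intro i
    simp only
    fun_prop

theorem continuous_w : Continuous (w (n := n) (mh := mh) (mg := mg) (m := m)) := continuous_fst

theorem continuous_mult : Continuous (mult (n := n) (mh := mh) (mg := mg) (m := m)) := by
  refine continuous_pi fun k => ?_
  rcases k with i | i | i | i <;> simp only [mult, lam, mu, xi, nu, Sum.elim_inl, Sum.elim_inr] <;>
    fun_prop

end PrimalDual

namespace ParamMPCC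

variable {n np mh mg m : ℕ} (Q : ParamMPCC n np mh mg m)

/-- The joint constraint family `(h, g, G, H)`. -/
def con : ConIdx mh mg m → Vec n × Vec np → ℝ := Sum.elim Q.h (Sum.elim Q.g (Sum.elim Q.G Q.H))

theorem contDiff_con (k : ConIdx mh mg m) : ContDiff ℝ 2 (Q.con k) := by
  rcases k with i | i | i | i
  exacts [Q.contDiff_h i, Q.contDiff_g i, Q.contDiff_G i, Q.contDiff_H i]

theorem continuous_con (k : ConIdx mh mg m) : Continuous (Q.con k) := (Q.contDiff_con k).continuous

/-- The constraints vanishing at `(w, p)`. -/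
def vanishing (w : Vec n) (p : Vec np) : Set (ConIdx mh mg m) := {k | Q.con k (w, p) = 0}

/-- Linear independence of the `w`-gradients of all constraints that vanish at `(w, p)`. -/
def VanishingIndependent (w : Vec n) (p : Vec np) : Prop :=
  LinearIndependent ℝ fun k : Q.vanishing w p => dw (Q.con k) w p

theorem hasStrictFDerivAt_dw {φ : Vec n × Vec np → ℝ} (hφ : ContDiff ℝ 2 φ) (w : Vec n)
    (p : Vec np) : HasStrictFDerivAt (fun x => φ (x, p)) (dw φ w p) w := by
  have h : ContDiff ℝ 2 fun x => φ (x, p) := by fun_prop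
  exact h.contDiffAt.hasStrictFDerivAt (by norm_num)

theorem dw_eq {φ : Vec n × Vec np → ℝ} (hφ : ContDiff ℝ 2 φ) (w : Vec n) (p : Vec np) :
    dw φ w p = (fderiv ℝ φ (w, p)).comp (ContinuousLinearMap.inl ℝ (Vec n) (Vec np)) := by
  have h1 : HasFDerivAt φ (fderiv ℝ φ (w, p)) (w, p) :=
    (hφ.differentiable (by norm_num) _).hasFDerivAt
  exact (h1.comp w (hasFDerivAt_prodMk_left w p)).fderiv

theorem contDiff_dw {φ : Vec n × Vec np → ℝ} (hφ : ContDiff ℝ 2 φ) :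
    ContDiff ℝ 1 fun x : Vec n × Vec np => dw φ x.1 x.2 := by
  simp only [dw_eq hφ]
  have h : ContDiff ℝ 1 (fderiv ℝ φ) := hφ.fderiv_right (by norm_num)
  exact h.clm_comp contDiff_const

/-- The gradient of the Lagrangian as a function of `w`, the signed multipliers and `p`. -/
noncomputable def gradL (w : Vec n) (y : ConIdx mh mg m → ℝ) (p : Vec np) : Vec n →L[ℝ] ℝ :=
  dw Q.f w p + ∑ k, y k • dw (Q.con k) w p

theorem lagrangian_eq (z : PrimalDual n mh mg m) (p : Vec np) (w : Vec n) :
    Q.lagrangian z p w = Q.f (w, p) + ∑ k, z.mult k * Q.con k (w, p) := by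
  simp [lagrangian, PrimalDual.mult, con, Fintype.sum_sum_type]
  ring

theorem hasFDerivAt_lagrangian (z : PrimalDual n mh mg m) (p : Vec np) (w : Vec n) :
    HasFDerivAt (Q.lagrangian z p) (Q.gradL w z.mult p) w := by
  rw [funext (Q.lagrangian_eq z p)]
  refine (hasStrictFDerivAt_dw Q.contDiff_f w p).hasFDerivAt.add (HasFDerivAt.fun_sum fun k _ => ?_)
  exact (hasStrictFDerivAt_dw (Q.contDiff_con k) w p).hasFDerivAt.const_mul _

theorem fderiv_lagrangian (z : PrimalDual n mh mg m) (p : Vec np) :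
    fderiv ℝ (Q.lagrangian z p) = fun w => Q.gradL w z.mult p :=
  funext fun w => (Q.hasFDerivAt_lagrangian z p w).fderiv

theorem contDiff_gradL :
    ContDiff ℝ 1 fun x : Vec n × (ConIdx mh mg m → ℝ) × Vec np => Q.gradL x.1 x.2.1 x.2.2 := by
  have hpr : ContDiff ℝ 1 fun x : Vec n × (ConIdx mh mg m → ℝ) × Vec np => (x.1, x.2.2) := by
    fun_prop
  refine ((contDiff_dw Q.contDiff_f).comp hpr).add (ContDiff.sum fun k _ => ?_)
  have hy : ContDiff ℝ 1 fun x : Vec n × (ConIdx mh mg m → ℝ) × Vec np => x.2.1 k := by fun_prop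
  exact hy.smul ((contDiff_dw (Q.contDiff_con k)).comp hpr)

variable {Q}

theorem VanishingIndependent.eq_zero {w : Vec n} {p : Vec np} {S : Set (ConIdx mh mg m)}
    (h : Q.VanishingIndependent w p) (hS : S ⊆ Q.vanishing w p)
    {y : ConIdx mh mg m → ℝ} (hy : ∀ k ∉ S, y k = 0)
    (h0 : ∑ k, y k • dw (Q.con k) w p = 0) : y = 0 := by
  classical
  have hy' : ∀ k ∉ Q.vanishing w p, y k = 0 := fun k hk => hy k fun h => hk (hS h)
  have h1 := Fintype.linearIndependent_iff.1 h (fun k => y k) (by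
    rw [← h0]
    refine Finset.sum_of_injOn Subtype.val Subtype.val_injective.injOn (by simp)
      (fun k _ hk => ?_) (fun k _ => rfl)
    have hk' : k ∉ Q.vanishing w p := fun h => hk ⟨⟨k, h⟩, by simp, rfl⟩
    rw [hy' k hk']
    exact zero_smul ℝ _)
  funext k
  by_cases hk : k ∈ Q.vanishing w p
  · exact h1 ⟨k, hk⟩
  · exact hy' k hk

/-- Subfamilies of an independent family are independent. This gives both versions of LICQ a common
form in which no branch appears. -/
theorem GradientsIndependent.vanishingIndependent {w : Vec n} {p : Vec np} {A : Set (Fin mg)}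
    {K L : Set (Fin m)} (h : Q.GradientsIndependent w p A K L)
    (hA : ∀ i, Q.g i (w, p) = 0 → i ∈ A) (hK : ∀ i, Q.G i (w, p) = 0 → i ∈ K)
    (hL : ∀ i, Q.H i (w, p) = 0 → i ∈ L) : Q.VanishingIndependent w p := by
  let e : Q.vanishing w p → Fin mh ⊕ A ⊕ K ⊕ L := fun k =>
    match k with
    | ⟨.inl i, _⟩ => .inl i
    | ⟨.inr (.inl i), hk⟩ => .inr (.inl ⟨i, hA i hk⟩)
    | ⟨.inr (.inr (.inl i)), hk⟩ => .inr (.inr (.inl ⟨i, hK i hk⟩))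
    | ⟨.inr (.inr (.inr i)), hk⟩ => .inr (.inr (.inr ⟨i, hL i hk⟩))
  have he : Function.Injective e := by
    rintro ⟨a | a | a | a, ha⟩ ⟨b | b | b | b, hb⟩ hab <;> simp_all [e]
  have h2 := LinearIndependent.comp h e he
  unfold VanishingIndependent
  convert h2 using 1
  funext k
  revert k
  rintro ⟨a | a | a | a, ha⟩ <;> rfl

theorem MPCCLICQ.vanishingIndependent {w : Vec n} {p : Vec np} (h : Q.MPCCLICQ w p)
    (hf : Q.Feasible w p) : Q.VanishingIndependent w p := by
  refine GradientsIndependent.vanishingIndependent h (fun i hi => hi) (fun i hi => ?_)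
    (fun i hi => ?_)
  · rcases (hf.2.2 i).2.1.eq_or_lt with h0 | h0
    exacts [Or.inr ⟨hi, h0.symm⟩, Or.inl ⟨hi, h0⟩]
  · rcases (hf.2.2 i).1.eq_or_lt with h0 | h0
    exacts [Or.inr ⟨h0.symm, hi⟩, Or.inl ⟨h0, hi⟩]

theorem BranchLICQ.vanishingIndependent {I : Set (Fin m)} {w : Vec n} {p : Vec np}
    (h : Q.BranchLICQ I w p) : Q.VanishingIndependent w p := by
  refine GradientsIndependent.vanishingIndependent h (fun i hi => hi) (fun i hi => ?_)
    (fun i hi => ?_) <;> by_cases h : i ∈ I <;> simp [h, hi]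

theorem BranchKKT.gradL_eq_zero {I : Set (Fin m)} {z : PrimalDual n mh mg m} {p : Vec np}
    (h : Q.BranchKKT I z p) : Q.gradL z.w z.mult p = 0 := by
  rw [← h.1, fderiv_lagrangian]

theorem BranchKKT.mult_eq_zero {I : Set (Fin m)} {z : PrimalDual n mh mg m} {p : Vec np}
    (h : Q.BranchKKT I z p) {k : ConIdx mh mg m} (hk : Q.con k (z.w, p) ≠ 0) : z.mult k = 0 := by
  obtain ⟨-, hh, hg, hI, hI'⟩ := h
  rcases k with i | i | i | i
  · exact absurd (hh i) hk
  · exact (mul_eq_zero.1 (hg i).2.2).resolve_right hk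
  · by_cases hi : i ∈ I
    · exact absurd (hI i hi).1 hk
    · exact neg_eq_zero.2 ((mul_eq_zero.1 (hI' i hi).2.2.2).resolve_right hk)
  · by_cases hi : i ∈ I
    · exact neg_eq_zero.2 ((mul_eq_zero.1 (hI i hi).2.2.2).resolve_right hk)
    · exact absurd (hI' i hi).1 hk

theorem BranchKKT.feasible {I : Set (Fin m)} {z : PrimalDual n mh mg m} {p : Vec np}
    (h : Q.BranchKKT I z p) : Q.Feasible z.w p := by
  obtain ⟨-, hh, hg, hI, hI'⟩ := h
  refine ⟨hh, fun i => (hg i).2.1, fun i => ?_⟩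
  by_cases hi : i ∈ I
  · simp [hI i hi]
  · simp [hI' i hi]

theorem mem_branches {I : Set (Fin m)} {w : Vec n} {p : Vec np} (hf : Q.Feasible w p)
    (hI : ∀ i ∈ I, Q.G i (w, p) = 0) (hI' : ∀ i ∉ I, Q.H i (w, p) = 0) : I ∈ Q.branches w p := by
  refine ⟨I ∩ Q.I00 w p, inter_subset_right, ?_⟩
  ext i
  constructor
  · intro hi
    rcases (hf.2.2 i).2.1.eq_or_lt with h0 | h0
    exacts [Or.inr ⟨hi, hI i hi, h0.symm⟩, Or.inl ⟨hI i hi, h0⟩]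
  · rintro (hi | hi)
    · by_contra h
      exact hi.2.ne' (hI' i h)
    · exact hi.1

theorem branches_G {I : Set (Fin m)} {w : Vec n} {p : Vec np} (h : I ∈ Q.branches w p) {i : Fin m}
    (hi : i ∈ I) : Q.G i (w, p) = 0 := by
  obtain ⟨J, hJ, rfl⟩ := h
  exact hi.elim (fun h => h.1) fun h => (hJ h).1

theorem branches_H {I : Set (Fin m)} {w : Vec n} {p : Vec np} (hf : Q.Feasible w p)
    (h : I ∈ Q.branches w p) {i : Fin m} (hi : i ∉ I) : Q.H i (w, p) = 0 := by
  obtain ⟨J, hJ, rfl⟩ := h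
  by_contra hH
  have h1 := hf.2.2 i
  exact hi (Or.inl ⟨(mul_eq_zero.1 h1.2.2).resolve_right hH, lt_of_le_of_ne h1.2.1 (Ne.symm hH)⟩)

/-- Multipliers of KKT points of branch problems with the same primal part agree. -/
theorem BranchKKT.eq_of_w_eq {I J : Set (Fin m)} {z z' : PrimalDual n mh mg m} {p : Vec np}
    (h : Q.BranchKKT I z p) (h' : Q.BranchKKT J z' p) (hw : z'.w = z.w)
    (hv : Q.VanishingIndependent z.w p) : z' = z := by
  -- The difference is supported on the vanishing constraints, and subtracting the two gradient
  -- equations cancels the gradient of `f`.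
  have hm : z'.mult - z.mult = 0 := by
    refine hv.eq_zero subset_rfl (fun k hk => ?_) ?_
    · simp [h.mult_eq_zero hk, h'.mult_eq_zero (k := k) (by rw [hw]; exact hk)]
    · have h1 := h.gradL_eq_zero
      have h2 := h'.gradL_eq_zero
      rw [hw] at h2
      simp only [gradL] at h1 h2
      have h3 : ∀ k, (z'.mult - z.mult) k • dw (Q.con k) z.w p =
          z'.mult k • dw (Q.con k) z.w p - z.mult k • dw (Q.con k) z.w p := fun k => by
        ext d
        simp [sub_mul]
      rw [Finset.sum_congr rfl fun k _ => h3 k, Finset.sum_sub_distrib,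
        eq_neg_of_add_eq_zero_right h1, eq_neg_of_add_eq_zero_right h2, sub_self]
  rw [← PrimalDual.ofMult_mult z, ← PrimalDual.ofMult_mult z', hw, sub_eq_zero.1 hm]

/-- A KKT point of a branch problem with nonnegative multipliers of the degenerate pairs is
S-stationary. -/
theorem BranchKKT.sStationary {I : Set (Fin m)} {z : PrimalDual n mh mg m} {p : Vec np}
    (h : Q.BranchKKT I z p) (hs : ∀ i ∈ Q.I00 z.w p, 0 ≤ z.xi i ∧ 0 ≤ z.nu i) :
    Q.SStationary z p := by
  refine ⟨h.feasible, h.1, fun i => ⟨(h.2.2.1 i).1, (h.2.2.1 i).2.2⟩, fun i hi => ?_,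
    fun i hi => ?_, hs⟩
  · simpa [PrimalDual.mult] using h.mult_eq_zero (k := .inr (.inr (.inr i))) hi.2.ne'
  · simpa [PrimalDual.mult] using h.mult_eq_zero (k := .inr (.inr (.inl i))) hi.1.ne'

/-- One multiplier vector serves every branch: in a nondegenerate pair the positive function has
multiplier zero, and in a degenerate pair both signs are available. -/
theorem SStationary.branchKKT {I : Set (Fin m)} {z : PrimalDual n mh mg m} {p : Vec np}
    (h : Q.SStationary z p) (hI : I ∈ Q.branches z.w p) : Q.BranchKKT I z p := by
  obtain ⟨hf, hL, hμ, hν, hξ, hs⟩ := h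
  refine ⟨hL, hf.1, fun i => ⟨(hμ i).1, hf.2.1 i, (hμ i).2⟩, fun i hi => ?_, fun i hi => ?_⟩
  · have hG := branches_G hI hi
    have hH := (hf.2.2 i).2.1
    refine ⟨hG, hH, ?_⟩
    rcases hH.eq_or_lt with h0 | h0
    · simp [← h0, (hs i ⟨hG, h0.symm⟩).2]
    · simp [hν i ⟨hG, h0⟩]
  · have hH := branches_H hf hI hi
    have hG := (hf.2.2 i).1
    refine ⟨hH, hG, ?_⟩
    rcases hG.eq_or_lt with h0 | h0
    · simp [← h0, (hs i ⟨h0.symm, hH⟩).1]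
    · simp [hξ i ⟨h0, hH⟩]

theorem SStationary.bStationary {z : PrimalDual n mh mg m} {p : Vec np}
    (h : Q.SStationary z p) : Q.BStationary z.w p :=
  ⟨h.1, fun _ hI => ⟨z, rfl, h.branchKKT hI⟩⟩

/-- At a B-stationary KKT point of a branch problem with independent gradients, the multipliers of
degenerate pairs are nonnegative. -/
theorem BranchKKT.nonneg_of_bStationary {I : Set (Fin m)} {z : PrimalDual n mh mg m} {p : Vec np}
    (h : Q.BranchKKT I z p) (hv : Q.VanishingIndependent z.w p) (hB : Q.BStationary z.w p)
    {i : Fin m} (hi : i ∈ Q.I00 z.w p) : 0 ≤ z.xi i ∧ 0 ≤ z.nu i := by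
  have hG : ∀ j ∈ I, Q.G j (z.w, p) = 0 := fun j hj => (h.2.2.2.1 j hj).1
  have hH : ∀ j ∉ I, Q.H j (z.w, p) = 0 := fun j hj => (h.2.2.2.2 j hj).1
  constructor
  -- With `i` outside the branch set, `G i` is an inequality constraint, so its multiplier is
  -- nonnegative; uniqueness of multipliers transfers the sign to `z`. For `ν`, put `i` inside.
  · have hb : I \ {i} ∈ Q.branches z.w p := by
      refine mem_branches hB.1 (fun j hj => hG j hj.1) fun j hj => ?_
      by_cases hji : j = i
      · exact hji ▸ hi.2
      · exact hH j fun h => hj ⟨h, hji⟩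
    obtain ⟨z', hw, hz'⟩ := hB.2 _ hb
    rw [← h.eq_of_w_eq hz' hw hv]
    exact (hz'.2.2.2.2 i (by simp)).2.2.1
  · have hb : I ∪ {i} ∈ Q.branches z.w p := by
      refine mem_branches hB.1 (fun j hj => ?_) fun j hj => hH j fun h => hj (Or.inl h)
      rcases hj with hj | rfl
      exacts [hG j hj, hi.1]
    obtain ⟨z', hw, hz'⟩ := hB.2 _ hb
    rw [← h.eq_of_w_eq hz' hw hv]
    exact (hz'.2.2.2.1 i (by simp)).2.2.1

end ParamMPCC

/-! ### Piecewise smoothness of branch solution maps -/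

/-- Implicit function theorem for a square system: near a regular zero, the zeros form the graph
of a continuously differentiable map of the parameter. -/
theorem exists_contDiffAt_implicit {X Z P : Type*} [NormedAddCommGroup X] [NormedSpace ℝ X]
    [NormedAddCommGroup Z] [NormedSpace ℝ Z] [NormedAddCommGroup P] [NormedSpace ℝ P]
    [FiniteDimensional ℝ X] [FiniteDimensional ℝ Z] [FiniteDimensional ℝ P]
    (hXZ : Module.finrank ℝ X = Module.finrank ℝ Z) {F : X × P → Z} {x₀ : X} {p₀ : P}
    (hF : ContDiffAt ℝ 1 F (x₀, p₀)) (h0 : F (x₀, p₀) = 0)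
    (hinj : ∀ x, fderiv ℝ F (x₀, p₀) (x, 0) = 0 → x = 0) :
    ∃ φ : P → X, ContDiffAt ℝ 1 φ p₀ ∧ ∀ᶠ a in 𝓝 (x₀, p₀), F a = 0 → a.1 = φ a.2 := by
  -- Adjoining the parameter makes the map a local diffeomorphism; `φ p` is read off the preimage of
  -- `(0, p)`.
  have hΦ : ContDiffAt ℝ 1 (fun a : X × P => (F a, a.2)) (x₀, p₀) := hF.prodMk contDiffAt_snd
  have hd : HasFDerivAt (fun a : X × P => (F a, a.2))
      ((fderiv ℝ F (x₀, p₀)).prod (ContinuousLinearMap.snd ℝ X P)) (x₀, p₀) :=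
    (hF.differentiableAt (by norm_num)).hasFDerivAt.prodMk hasFDerivAt_snd
  set D := (fderiv ℝ F (x₀, p₀)).prod (ContinuousLinearMap.snd ℝ X P) with hD
  have hDinj : Function.Injective D := by
    rw [injective_iff_map_eq_zero]
    rintro ⟨x, q⟩ hx
    simp only [hD, ContinuousLinearMap.prod_apply, ContinuousLinearMap.coe_snd',
      Prod.mk_eq_zero] at hx
    obtain ⟨h1, rfl⟩ := hx
    rw [hinj x h1, Prod.mk_zero_zero]
  let e : (X × P) ≃L[ℝ] (Z × P) := (LinearMap.linearEquivOfInjective D.toLinearMap hDinj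
    (by simp [hXZ])).toContinuousLinearEquiv
  have he : (e : X × P →L[ℝ] Z × P) = D := by
    ext a <;> rfl
  rw [← he] at hd
  refine ⟨fun p => (hΦ.localInverse hd one_ne_zero (0, p)).1, ?_, ?_⟩
  · have h1 := hΦ.to_localInverse hd one_ne_zero
    simp only [h0] at h1
    exact (h1.comp p₀ (contDiffAt_const.prodMk contDiffAt_id)).fst
  · have hs := hΦ.hasStrictFDerivAt' hd one_ne_zero
    filter_upwards [hs.eventually_left_inverse] with a ha hFa
    rw [hFa] at ha
    exact (congrArg Prod.fst ha).symm

namespace ParamMPCC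

variable {n np mh mg m : ℕ} {Q : ParamMPCC n np mh mg m}

/-- Near a primal-dual point at which the gradients of the working set `A` are independent and the
Hessian of the Lagrangian is positive definite on their common kernel, the solutions of the KKT
equations of the working set are given by a continuously differentiable map of the parameter. -/
theorem exists_contDiffAt_workingSet {z₀ : PrimalDual n mh mg m} {p₀ : Vec np}
    {A : Set (ConIdx mh mg m)} (hA : A ⊆ Q.vanishing z₀.w p₀)
    (hL : Q.gradL z₀.w z₀.mult p₀ = 0) (hy : ∀ k ∉ A, z₀.mult k = 0)
    (hv : Q.VanishingIndependent z₀.w p₀)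
    (hpos : ∀ d, (∀ k ∈ A, dw (Q.con k) z₀.w p₀ d = 0) → d ≠ 0 → 0 < Q.hessForm z₀ p₀ d) :
    ∃ φ : Vec np → PrimalDual n mh mg m, ContDiffAt ℝ 1 φ p₀ ∧
      ∀ᶠ a in 𝓝 (z₀, p₀), Q.gradL a.1.w a.1.mult a.2 = 0 →
        (∀ k ∈ A, Q.con k (a.1.w, a.2) = 0) → (∀ k ∉ A, a.1.mult k = 0) → a.1 = φ a.2 := by
  classical
  -- The system is square: each index contributes its constraint if it lies in `A`, and the
  -- vanishing of its multiplier otherwise.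
  let F : (Vec n × (ConIdx mh mg m → ℝ)) × Vec np → (Vec n →L[ℝ] ℝ) × (ConIdx mh mg m → ℝ) :=
    fun a => (Q.gradL a.1.1 a.1.2 a.2, fun k => if k ∈ A then Q.con k (a.1.1, a.2) else a.1.2 k)
  have hF : ContDiff ℝ 1 F := by
    refine ContDiff.prodMk ?_ (contDiff_pi.2 fun k => ?_)
    · exact Q.contDiff_gradL.comp
        (f := fun a : (Vec n × (ConIdx mh mg m → ℝ)) × Vec np => (a.1.1, a.1.2, a.2)) (by fun_prop)
    · have hc : ContDiff ℝ 1 (Q.con k) := (Q.contDiff_con k).of_le (by norm_num)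
      by_cases hk : k ∈ A
      · simp only [hk, if_true]
        fun_prop
      · simp only [hk, if_false]
        fun_prop
  have hF0 : F ((z₀.w, z₀.mult), p₀) = 0 := by
    refine Prod.ext hL (funext fun k => ?_)
    by_cases hk : k ∈ A
    · have h1 : Q.con k (z₀.w, p₀) = 0 := hA hk
      simpa [F, hk] using h1
    · simpa [F, hk] using hy k hk
  have hd := (hF.differentiable (by norm_num) ((z₀.w, z₀.mult), p₀)).hasFDerivAt
  have hinj : ∀ x, fderiv ℝ F ((z₀.w, z₀.mult), p₀) (x, 0) = 0 → x = 0 := by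
    rintro ⟨d, η⟩ hx
    set D := fderiv ℝ F ((z₀.w, z₀.mult), p₀) with hD
    have hw : HasFDerivAt (fun w => F ((w, z₀.mult), p₀)) (D.comp ((ContinuousLinearMap.inl ℝ
        (Vec n × (ConIdx mh mg m → ℝ)) (Vec np)).comp (ContinuousLinearMap.inl ℝ (Vec n)
        (ConIdx mh mg m → ℝ)))) z₀.w :=
      hd.comp (f := fun w => ((w, z₀.mult), p₀)) z₀.w
        (HasFDerivAt.comp (g := fun x => (x, p₀)) z₀.w
          (hasFDerivAt_prodMk_left (z₀.w, z₀.mult) p₀) (hasFDerivAt_prodMk_left z₀.w z₀.mult))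
    have hη : HasFDerivAt (fun y => F ((z₀.w, y), p₀)) (D.comp ((ContinuousLinearMap.inl ℝ
        (Vec n × (ConIdx mh mg m → ℝ)) (Vec np)).comp (ContinuousLinearMap.inr ℝ (Vec n)
        (ConIdx mh mg m → ℝ)))) z₀.mult :=
      hd.comp (f := fun y => ((z₀.w, y), p₀)) z₀.mult
        (HasFDerivAt.comp (g := fun x => (x, p₀)) z₀.mult
          (hasFDerivAt_prodMk_left (z₀.w, z₀.mult) p₀) (hasFDerivAt_prodMk_right z₀.w z₀.mult))
    have hsum : D ((d, 0), 0) + D ((0, η), 0) = 0 := by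
      rw [← map_add, ← hx]
      simp
    have hw1 : (D ((d, 0), 0)).1 = fderiv ℝ (fun w => Q.gradL w z₀.mult p₀) z₀.w d := by
      rw [(hw.fst).fderiv]
      rfl
    have hη1 : (D ((0, η), 0)).1 = ∑ k, η k • dw (Q.con k) z₀.w p₀ := by
      have h1 : HasFDerivAt (fun y => Q.gradL z₀.w y p₀)
          (∑ k, (ContinuousLinearMap.proj (R := ℝ) (φ := fun _ : ConIdx mh mg m => ℝ) k).smulRight
            (dw (Q.con k) z₀.w p₀)) z₀.mult := by
        refine (HasFDerivAt.fun_sum fun k _ => ?_).const_add _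
        exact (hasFDerivAt_apply k z₀.mult).smul_const (dw (Q.con k) z₀.w p₀)
      have h2 := congrArg (fun T => T η) (hη.fst.unique h1)
      simpa using h2
    have hw2 : ∀ k, (D ((d, 0), 0)).2 k = if k ∈ A then dw (Q.con k) z₀.w p₀ d else 0 := by
      intro k
      have h1 := (hasFDerivAt_pi'.1 hw.snd k)
      split_ifs with hk
      · simp only [F, hk, if_true] at h1
        exact congrArg (fun T => T d)
          (h1.unique (hasStrictFDerivAt_dw (Q.contDiff_con k) z₀.w p₀).hasFDerivAt)
      · simp only [F, hk, if_false] at h1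
        exact congrArg (fun T => T d) (h1.unique (hasFDerivAt_const (z₀.mult k) z₀.w))
    have hη2 : ∀ k, (D ((0, η), 0)).2 k = if k ∈ A then 0 else η k := by
      intro k
      have h1 := (hasFDerivAt_pi'.1 hη.snd k)
      split_ifs with hk
      · simp only [F, hk, if_true] at h1
        exact congrArg (fun T => T η)
          (h1.unique (hasFDerivAt_const (Q.con k (z₀.w, p₀)) z₀.mult))
      · simp only [F, hk, if_false] at h1
        exact congrArg (fun T => T η) (h1.unique (hasFDerivAt_apply k z₀.mult))
    have hk2 : ∀ k, (D ((d, 0), 0)).2 k + (D ((0, η), 0)).2 k = 0 := fun k =>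
      congrFun (congrArg Prod.snd hsum) k
    have hdA : ∀ k ∈ A, dw (Q.con k) z₀.w p₀ d = 0 := fun k hk => by
      simpa [hw2, hη2, hk] using hk2 k
    have hηA : ∀ k ∉ A, η k = 0 := fun k hk => by simpa [hw2, hη2, hk] using hk2 k
    have h1 : fderiv ℝ (fun w => Q.gradL w z₀.mult p₀) z₀.w d +
        ∑ k, η k • dw (Q.con k) z₀.w p₀ = 0 := by
      rw [← hw1, ← hη1]
      exact congrArg Prod.fst hsum
    -- Evaluating the linearized stationarity equation at `d` kills the multiplier term, since `η`
    -- is supported on `A` and `d` annihilates the gradients in `A`. Only the Hessian form remains.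
    have hd0 : d = 0 := by
      by_contra hne
      have h2 := hpos d hdA hne
      have h3 := congrArg (fun T => T d) h1
      have h4 : ∑ k, η k * dw (Q.con k) z₀.w p₀ d = 0 := Finset.sum_eq_zero fun k _ => by
        by_cases hk : k ∈ A
        · simp [hdA k hk]
        · simp [hηA k hk]
      simp only [add_apply, sum_apply, smul_apply, smul_eq_mul, h4,
        zero_apply, add_zero] at h3
      rw [hessForm, fderiv_lagrangian] at h2
      exact h2.ne' h3
    have hη0 : η = 0 := by
      refine hv.eq_zero hA hηA ?_
      simpa [hd0] using h1
    rw [hd0, hη0, Prod.mk_zero_zero]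
  obtain ⟨φ, hφ, hu⟩ := exists_contDiffAt_implicit (by
    simp [← LinearMap.toContinuousLinearMap.finrank_eq])
    hF.contDiffAt hF0 hinj
  refine ⟨fun p => PrimalDual.ofMult (φ p), PrimalDual.contDiff_ofMult.contDiffAt.comp p₀ hφ, ?_⟩
  have hc : Continuous fun a : PrimalDual n mh mg m × Vec np => ((a.1.w, a.1.mult), a.2) :=
    ((PrimalDual.continuous_w.comp continuous_fst).prodMk
      (PrimalDual.continuous_mult.comp continuous_fst)).prodMk continuous_snd
  filter_upwards [(hc.tendsto (z₀, p₀)).eventually hu] with a ha hL' hA' hy'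
  rw [← ha, PrimalDual.ofMult_mult]
  refine Prod.ext hL' (funext fun k => ?_)
  by_cases hk : k ∈ A
  · simpa [F, hk] using hA' k hk
  · simpa [F, hk] using hy' k hk

/-- A solution map of a branch problem is piecewise continuously differentiable. -/
theorem BranchSolutionMap.pc1At {I : Set (Fin m)} {U : Set (Vec np)}
    {z : Vec np → PrimalDual n mh mg m} (hz : Q.BranchSolutionMap I U z) (hU : IsOpen U)
    {p : Vec np} (hp : p ∈ U) : PC1At z p := by
  classical
  obtain ⟨hcont, hsol⟩ := hz
  obtain ⟨hK, hLI, hSS⟩ := hsol p hp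
  have hv := hLI.vanishingIndependent
  have hzc : ContinuousAt z p := hcont.continuousAt (hU.mem_nhds hp)
  have hpair : Tendsto (fun q => (z q, q)) (𝓝 p) (𝓝 (z p, p)) := hzc.prodMk_nhds tendsto_id
  have hφ : ∀ A : Set (ConIdx mh mg m), ∃ φ : Vec np → PrimalDual n mh mg m,
      ContDiffAt ℝ 1 φ p ∧ ∀ᶠ q in 𝓝 p, q ∈ U → Q.vanishing (z q).w q = A → z q = φ q := by
    intro A
    by_cases hA : (A ⊆ Q.vanishing (z p).w p ∧ ∀ k ∉ A, (z p).mult k = 0) ∧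
      ∀ d, (∀ k ∈ A, dw (Q.con k) (z p).w p d = 0) → d ≠ 0 → 0 < Q.hessForm (z p) p d
    · obtain ⟨φ, h1, h2⟩ := exists_contDiffAt_workingSet hA.1.1 hK.gradL_eq_zero hA.1.2 hv hA.2
      refine ⟨φ, h1, ?_⟩
      filter_upwards [hpair.eventually h2] with q hq hqU hqA
      have hKq := (hsol q hqU).1
      refine hq hKq.gradL_eq_zero (fun k hk => ?_) fun k hk => hKq.mult_eq_zero fun h => hk ?_
      · rw [← hqA] at hk
        exact hk
      · rw [← hqA]
        exact h
    -- Such an `A` is not the vanishing set for any `q` near `p`, so any piece will do. Indeed,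
    -- nonzero constraints and nonzero multipliers stay nonzero nearby. So `A` would consist of
    -- constraints vanishing at `p` and contain all those with nonzero multiplier; its kernel would
    -- lie in the strong critical cone, and SSOSC would contradict `hA`.
    · refine ⟨fun _ => z p, contDiffAt_const, ?_⟩
      have hcc : ∀ k, Tendsto (fun q => Q.con k ((z q).w, q)) (𝓝 p) (𝓝 (Q.con k ((z p).w, p))) :=
        fun k => ((Q.continuous_con k).tendsto _).comp
          (((PrimalDual.continuous_w.tendsto _).comp hzc).prodMk_nhds tendsto_id)
      have hmc : ∀ k, Tendsto (fun q => (z q).mult k) (𝓝 p) (𝓝 ((z p).mult k)) := fun k =>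
        (((continuous_apply k).comp PrimalDual.continuous_mult).tendsto _).comp hzc
      have e1 : ∀ᶠ q in 𝓝 p, ∀ k, Q.con k ((z p).w, p) ≠ 0 → Q.con k ((z q).w, q) ≠ 0 :=
        eventually_all.2 fun k => eventually_imp_distrib_left.2 fun h => (hcc k).eventually_ne h
      have e2 : ∀ᶠ q in 𝓝 p, ∀ k, (z p).mult k ≠ 0 → (z q).mult k ≠ 0 :=
        eventually_all.2 fun k => eventually_imp_distrib_left.2 fun h => (hmc k).eventually_ne h
      filter_upwards [e1, e2] with q h1 h2 hqU hqA
      have hKq := (hsol q hqU).1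
      have hmem : ∀ k, (z p).mult k ≠ 0 → k ∈ A := fun k hk => by
        rw [← hqA]
        by_contra h
        exact h2 k hk (hKq.mult_eq_zero h)
      refine absurd ⟨⟨fun k hk => ?_, fun k hk => ?_⟩, fun d hd hd0 => hSS d ?_ hd0⟩ hA
      · by_contra h
        rw [← hqA] at hk
        exact h1 k h hk
      · by_contra h
        exact hk (hmem k h)
      · refine ⟨fun i => hd (.inl i) ?_, fun i _ hi => hd (.inr (.inl i)) (hmem _ hi.ne'),
          fun i hi => hd (.inr (.inr (.inl i))) ?_, fun i hi => hd (.inr (.inr (.inr i))) ?_⟩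
        · rw [← hqA]
          exact hKq.2.1 i
        · rcases hi with hi | hi
          · rw [← hqA]
            exact (hKq.2.2.2.1 i hi).1
          · exact hmem _ (neg_ne_zero.2 hi.2.ne')
        · rcases hi with hi | hi
          · rw [← hqA]
            exact (hKq.2.2.2.2 i hi).1
          · exact hmem _ (neg_ne_zero.2 hi.2.ne')
  choose φ hφ1 hφ2 using hφ
  have hφ3 : ∀ A, ∀ᶠ q in 𝓝 p, ContDiffAt ℝ 1 (φ A) q := fun A => (hφ1 A).eventually (by simp)
  obtain ⟨V, hV, hVo, hpV⟩ := eventually_nhds_iff.1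
    (((eventually_all.2 hφ3).and (eventually_all.2 hφ2)).and (hU.mem_nhds hp))
  let e := Fintype.equivFin (Set (ConIdx mh mg m))
  refine ⟨V, hVo, hpV, hcont.mono fun q hq => (hV q hq).2, _, fun k => φ (e.symm k),
    fun k q hq => ((hV q hq).1.1 _).contDiffWithinAt, fun q hq => ⟨e (Q.vanishing (z q).w q), ?_⟩⟩
  simp only [Equiv.symm_apply_apply]
  exact (hV q hq).1.2 _ (hV q hq).2 rfl

end ParamMPCC

/-! ### The second-order sufficient condition -/

theorem HasFDerivAt.tendsto_inv_norm_mul_sub {E : Type*} [NormedAddCommGroup E] [NormedSpace ℝ E]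
    {φ : E → ℝ} {φ' : E →L[ℝ] ℝ} {x d : E} {l : Filter E} (hφ : HasFDerivAt φ φ' x)
    (hl : l ≤ 𝓝 x) (hd : Tendsto (fun y => ‖y - x‖⁻¹ • (y - x)) l (𝓝 d)) :
    Tendsto (fun y => ‖y - x‖⁻¹ * (φ y - φ x)) l (𝓝 (φ' d)) := by
  have h1 : Tendsto (fun y => ‖y - x‖⁻¹ * (φ y - φ x - φ' (y - x))) l (𝓝 0) := by
    rw [tendsto_zero_iff_norm_tendsto_zero]
    refine ((hasFDerivAt_iff_tendsto.1 hφ).mono_left hl).congr fun y => ?_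
    rw [norm_mul, norm_inv, norm_norm]
  have h2 := h1.add ((φ'.continuous.tendsto d).comp hd)
  rw [zero_add] at h2
  refine h2.congr fun y => ?_
  simp only [Function.comp, map_smul, smul_eq_mul]
  ring

/-- If `L` does not increase along a filter approaching a critical point `x` in the direction `d`,
then the second derivative of `L` at `x` is nonpositive at `d`. -/
theorem second_derivative_nonpos {E : Type*} [NormedAddCommGroup E] [NormedSpace ℝ E]
    {L : E → ℝ} {L' : E → E →L[ℝ] ℝ} {A : E →L[ℝ] E →L[ℝ] ℝ} {x d : E} {l : Filter E} [NeBot l]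
    (hL : ∀ y, HasFDerivAt L (L' y) y) (hA : HasFDerivAt L' A x) (h0 : L' x = 0)
    (hl : l ≤ 𝓝[≠] x) (hle : ∀ᶠ y in l, L y ≤ L x)
    (hd : Tendsto (fun y => ‖y - x‖⁻¹ • (y - x)) l (𝓝 d)) : A d d ≤ 0 := by
  refine le_of_forall_pos_le_add fun ε hε => ?_
  rw [zero_add]
  obtain ⟨δ, hδ, hball⟩ := Metric.eventually_nhds_iff.1 (hA.isLittleO.def hε)
  have hlim : Tendsto (fun y => A (‖y - x‖⁻¹ • (y - x)) (‖y - x‖⁻¹ • (y - x))) l (𝓝 (A d d)) :=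
    ((by fun_prop : Continuous fun e => A e e).tendsto d).comp hd
  refine le_of_tendsto hlim ?_
  have hlx : l ≤ 𝓝 x := hl.trans nhdsWithin_le_nhds
  filter_upwards [hle, hl self_mem_nhdsWithin, hlx (Metric.ball_mem_nhds x hδ)] with y hy hne hyδ
  obtain ⟨u, rfl⟩ : ∃ u, y = x + u := ⟨y - x, by abel⟩
  simp only [add_sub_cancel_left]
  have hu : 0 < ‖u‖ := norm_pos_iff.2 fun h => hne (by simp [h])
  have huδ : ‖u‖ < δ := by simpa using hyδ
  have hder : ∀ t : ℝ, HasDerivAt (fun t : ℝ => L (x + t • u)) (L' (x + t • u) u) t := by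
    intro t
    have h1 : HasDerivAt (fun t : ℝ => x + t • u) u t := by
      simpa using ((hasDerivAt_id t).smul_const u).const_add x
    exact (hL (x + t • u)).comp_hasDerivAt t h1
  -- The mean value theorem replaces a second-order expansion: some `L' (x + t • u) u` is
  -- nonpositive, and it equals `t * A u u` up to `t * ε * ‖u‖ ^ 2`.
  obtain ⟨t, ht, hslope⟩ := exists_hasDerivAt_eq_slope (fun t : ℝ => L (x + t • u))
    (fun t => L' (x + t • u) u) one_pos
    (fun t _ => (hder t).continuousAt.continuousWithinAt) fun t _ => hder t
  simp only [one_smul, zero_smul, add_zero, sub_zero, div_one] at hslope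
  have hneg : L' (x + t • u) u ≤ 0 := by linarith
  have hr := hball (y := x + t • u) (by
    rw [dist_eq_norm, add_sub_cancel_left, norm_smul, Real.norm_of_nonneg ht.1.le]
    nlinarith [ht.1, ht.2])
  rw [h0, sub_zero, add_sub_cancel_left, norm_smul, Real.norm_of_nonneg ht.1.le] at hr
  have h3 := (Real.norm_eq_abs _ ▸ (L' (x + t • u) - A (t • u)).le_opNorm u : |_| ≤ _)
  have h4 : |L' (x + t • u) u - t * A u u| ≤ t * (ε * ‖u‖ ^ 2) := by
    have h5 := mul_le_mul_of_nonneg_right hr hu.le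
    simp only [sub_apply, map_smul, smul_apply, smul_eq_mul] at h3
    simp only [map_smul] at h5
    refine (h3.trans h5).trans (le_of_eq (by ring))
  have h6 : t * A u u ≤ t * (ε * ‖u‖ ^ 2) := by linarith [(abs_le.1 h4).1]
  have h7 : A u u ≤ ε * ‖u‖ ^ 2 := le_of_mul_le_mul_left h6 ht.1
  simp only [map_smul, smul_apply, smul_eq_mul]
  calc ‖u‖⁻¹ * (‖u‖⁻¹ * A u u) ≤ ‖u‖⁻¹ * (‖u‖⁻¹ * (ε * ‖u‖ ^ 2)) := by gcongr
    _ = ε := by field_simp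

namespace ParamMPCC

variable {n np mh mg m : ℕ} {Q : ParamMPCC n np mh mg m}

theorem SStationary.gradL_eq_zero {z : PrimalDual n mh mg m} {p : Vec np}
    (h : Q.SStationary z p) : Q.gradL z.w z.mult p = 0 := by
  rw [← h.2.1, fderiv_lagrangian]

theorem SStationary.mult_mul_con {z : PrimalDual n mh mg m} {p : Vec np}
    (h : Q.SStationary z p) (k : ConIdx mh mg m) : z.mult k * Q.con k (z.w, p) = 0 := by
  have hb : {i | Q.G i (z.w, p) = 0} ∈ Q.branches z.w p :=
    mem_branches h.1 (fun i hi => hi) fun i hi =>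
      (mul_eq_zero.1 (h.1.2.2 i).2.2).resolve_left hi
  by_cases hk : Q.con k (z.w, p) = 0
  · rw [hk, mul_zero]
  · rw [(h.branchKKT hb).mult_eq_zero hk, zero_mul]

/-- Near an S-stationary point the constraint terms of the Lagrangian are nonpositive at feasible
points. -/
theorem SStationary.eventually_mult_mul_con_nonpos {z : PrimalDual n mh mg m} {p : Vec np}
    (h : Q.SStationary z p) :
    ∀ᶠ w in 𝓝 z.w, Q.Feasible w p → ∀ k, z.mult k * Q.con k (w, p) ≤ 0 := by
  obtain ⟨hf, -, hμ, hν, hξ, hs⟩ := h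
  have hc : ∀ k, Tendsto (fun w => Q.con k (w, p)) (𝓝 z.w) (𝓝 (Q.con k (z.w, p))) := fun k =>
    ((Q.continuous_con k).comp (by fun_prop : Continuous fun w : Vec n => (w, p))).tendsto z.w
  have hne : ∀ᶠ w in 𝓝 z.w, ∀ k, Q.con k (z.w, p) ≠ 0 → Q.con k (w, p) ≠ 0 :=
    eventually_all.2 fun k => eventually_imp_distrib_left.2 fun h => (hc k).eventually_ne h
  filter_upwards [hne] with w hw hfw k
  rcases k with i | i | i | i
  · have h1 := hfw.1 i
    simp [PrimalDual.mult, con, h1]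
  · exact mul_nonpos_of_nonneg_of_nonpos (hμ i).1 (hfw.2.1 i)
  · obtain ⟨hG, hH, hGH⟩ := hfw.2.2 i
    -- If `H i` vanishes at `z.w`, then the multiplier `ξ i` is nonnegative. Otherwise `H i` stays
    -- nonzero nearby, and complementarity forces `G i = 0`.
    rcases eq_or_ne (Q.H i (z.w, p)) 0 with h0 | h0
    · refine mul_nonpos_of_nonpos_of_nonneg (neg_nonpos.2 ?_) hG
      rcases (hf.2.2 i).1.eq_or_lt with h1 | h1
      exacts [(hs i ⟨h1.symm, h0⟩).1, (hξ i ⟨h1, h0⟩).ge]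
    · have h1 : Q.G i (w, p) = 0 :=
        (mul_eq_zero.1 hGH).resolve_right (hw (.inr (.inr (.inr i))) h0)
      simp [con, h1]
  · obtain ⟨hG, hH, hGH⟩ := hfw.2.2 i
    rcases eq_or_ne (Q.G i (z.w, p)) 0 with h0 | h0
    · refine mul_nonpos_of_nonpos_of_nonneg (neg_nonpos.2 ?_) hH
      rcases (hf.2.2 i).2.1.eq_or_lt with h1 | h1
      exacts [(hs i ⟨h0, h1.symm⟩).2, (hν i ⟨h0, h1⟩).ge]
    · have h1 : Q.H i (w, p) = 0 :=
        (mul_eq_zero.1 hGH).resolve_left (hw (.inr (.inr (.inl i))) h0)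
      simp [con, h1]

/-- An S-stationary point satisfying the strong second-order condition is a strict local
minimizer. -/
theorem SStationary.eventually_lt {z : PrimalDual n mh mg m} {p : Vec np}
    (h : Q.SStationary z p) (hpos : ∀ d ∈ Q.strongMPCCCone z p, d ≠ 0 → 0 < Q.hessForm z p d) :
    ∀ᶠ w in 𝓝 z.w, Q.Feasible w p → w ≠ z.w → Q.f (z.w, p) < Q.f (w, p) := by
  by_contra hcon
  let X : Set (Vec n) := {w | Q.Feasible w p ∧ w ≠ z.w ∧ Q.f (w, p) ≤ Q.f (z.w, p)}
  have hX : ∃ᶠ w in 𝓝 z.w, w ∈ X := by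
    refine (not_eventually.1 hcon).mono fun w hw => ?_
    push Not at hw
    exact ⟨hw.1, hw.2.1, hw.2.2⟩
  have hne : NeBot (𝓝[X] z.w) := mem_closure_iff_nhdsWithin_neBot.1
    (mem_closure_iff_frequently.2 hX)
  -- The ultrafilter replaces repeated passage to subsequences: normalized directions converge by
  -- compactness, and each alternative `G i = 0` or `H i = 0` is decided.
  let u : Ultrafilter (Vec n) := Ultrafilter.of (𝓝[X] z.w)
  have huX : ∀ᶠ w in (u : Filter (Vec n)), w ∈ X :=
    Ultrafilter.of_le (𝓝[X] z.w) self_mem_nhdsWithin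
  have hu : (u : Filter (Vec n)) ≤ 𝓝 z.w :=
    (Ultrafilter.of_le (𝓝[X] z.w)).trans nhdsWithin_le_nhds
  have hu' : (u : Filter (Vec n)) ≤ 𝓝[≠] z.w :=
    le_inf hu (le_principal_iff.2 (huX.mono fun w hw => hw.2.1))
  obtain ⟨d, hdS, hd⟩ := (isCompact_sphere (0 : Vec n) 1).ultrafilter_le_nhds
    (u.map fun w => ‖w - z.w‖⁻¹ • (w - z.w)) (by
      refine le_principal_iff.2 (huX.mono fun w hw => ?_)
      have h1 : ‖w - z.w‖ ≠ 0 := norm_ne_zero_iff.2 (sub_ne_zero.2 hw.2.1)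
      simp [norm_smul, h1])
  replace hd : Tendsto (fun w => ‖w - z.w‖⁻¹ • (w - z.w)) u (𝓝 d) := hd
  have hd0 : d ≠ 0 := by
    rintro rfl
    simp at hdS
  have hlim : ∀ k, Tendsto (fun w => ‖w - z.w‖⁻¹ * (Q.con k (w, p) - Q.con k (z.w, p))) u
      (𝓝 (dw (Q.con k) z.w p d)) := fun k =>
    (hasStrictFDerivAt_dw (Q.contDiff_con k) z.w p).hasFDerivAt.tendsto_inv_norm_mul_sub hu hd
  have hcon0 : ∀ k, (∀ᶠ w in (u : Filter (Vec n)), Q.con k (w, p) = 0) →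
      Q.con k (z.w, p) = 0 := fun k hk => by
    have h1 : Tendsto (fun w => Q.con k (w, p)) u (𝓝 (Q.con k (z.w, p))) :=
      (((Q.continuous_con k).comp
        (by fun_prop : Continuous fun w : Vec n => (w, p))).tendsto z.w).mono_left hu
    exact tendsto_nhds_unique h1 (tendsto_const_nhds.congr' (hk.mono fun w hw => hw.symm))
  have hdw0 : ∀ k, (∀ᶠ w in (u : Filter (Vec n)), Q.con k (w, p) = 0) →
      dw (Q.con k) z.w p d = 0 := fun k hk => by
    refine tendsto_nhds_unique (hlim k) (tendsto_const_nhds.congr' (hk.mono fun w hw => ?_))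
    simp only [hw, hcon0 k hk, sub_zero, mul_zero]
  have hterm : ∀ᶠ w in (u : Filter (Vec n)), ∀ k, z.mult k * Q.con k (w, p) ≤ 0 :=
    ((h.eventually_mult_mul_con_nonpos.filter_mono hu).and huX).mono fun w hw => hw.1 hw.2.1
  have hterm' : ∀ k, z.mult k * dw (Q.con k) z.w p d ≤ 0 := fun k => by
    refine le_of_tendsto ((hlim k).const_mul (z.mult k)) (hterm.mono fun w hw => ?_)
    have h1 : z.mult k * (‖w - z.w‖⁻¹ * (Q.con k (w, p) - Q.con k (z.w, p))) =
        ‖w - z.w‖⁻¹ * (z.mult k * Q.con k (w, p) - z.mult k * Q.con k (z.w, p)) := by ring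
    rw [h1, h.mult_mul_con k, sub_zero]
    exact mul_nonpos_of_nonneg_of_nonpos (by positivity) (hw k)
  have hfd : dw Q.f z.w p d ≤ 0 := by
    refine le_of_tendsto ((hasStrictFDerivAt_dw Q.contDiff_f z.w
      p).hasFDerivAt.tendsto_inv_norm_mul_sub hu hd) (huX.mono fun w hw => ?_)
    exact mul_nonpos_of_nonneg_of_nonpos (by positivity) (sub_nonpos.2 hw.2.2)
  have hsum : dw Q.f z.w p d + ∑ k, z.mult k * dw (Q.con k) z.w p d = 0 := by
    have h1 := congrArg (fun T => T d) h.gradL_eq_zero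
    simpa [gradL] using h1
  -- The terms are nonpositive, but by stationarity their sum is minus the slope of `f`, which is
  -- nonnegative. Hence each is zero.
  have hterm0 : ∀ k, z.mult k ≠ 0 → dw (Q.con k) z.w p d = 0 := fun k hk => by
    have h1 : ∑ k, z.mult k * dw (Q.con k) z.w p d = 0 :=
      le_antisymm (Finset.sum_nonpos fun k _ => hterm' k) (by linarith)
    exact (mul_eq_zero.1 ((Finset.sum_eq_zero_iff_of_nonpos fun k _ => hterm' k).1 h1 k
      (Finset.mem_univ k))).resolve_left hk
  -- This is the branch on which the ultrafilter lives; the limit direction lies in its strong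
  -- critical cone.
  let I : Set (Fin m) := {i | ∀ᶠ w in (u : Filter (Vec n)), Q.G i (w, p) = 0}
  have hI' : ∀ i ∉ I, ∀ᶠ w in (u : Filter (Vec n)), Q.H i (w, p) = 0 := fun i hi =>
    (Ultrafilter.eventually_or.1
      (huX.mono fun w hw => mul_eq_zero.1 (hw.1.2.2 i).2.2)).resolve_left hi
  have hIb : I ∈ Q.branches z.w p :=
    mem_branches h.1 (fun i hi => hcon0 (.inr (.inr (.inl i))) hi)
      fun i hi => hcon0 (.inr (.inr (.inr i))) (hI' i hi)
  have hdC : d ∈ Q.strongMPCCCone z p := by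
    refine mem_biUnion hIb ⟨fun i => hdw0 (.inl i) (huX.mono fun w hw => hw.1.1 i),
      fun i _ hi => hterm0 (.inr (.inl i)) hi.ne', fun i hi => ?_, fun i hi => ?_⟩
    · rcases hi with hi | hi
      · exact hdw0 (.inr (.inr (.inl i))) hi
      · exact hterm0 (.inr (.inr (.inl i))) (neg_ne_zero.2 hi.2.ne')
    · rcases hi with hi | hi
      · exact hdw0 (.inr (.inr (.inr i))) (hI' i hi)
      · exact hterm0 (.inr (.inr (.inr i))) (neg_ne_zero.2 hi.2.ne')
  have hle : ∀ᶠ w in (u : Filter (Vec n)), Q.lagrangian z p w ≤ Q.lagrangian z p z.w := by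
    filter_upwards [hterm, huX] with w hw hwX
    rw [lagrangian_eq, lagrangian_eq, Finset.sum_congr rfl fun k _ => h.mult_mul_con k]
    have h1 := Finset.sum_nonpos fun k (_ : k ∈ Finset.univ) => hw k
    simp only [Finset.sum_const_zero]
    linarith [hwX.2.2]
  have hgr : ContDiff ℝ 1 fun w => Q.gradL w z.mult p :=
    Q.contDiff_gradL.comp (f := fun w => (w, z.mult, p)) (by fun_prop)
  have h2 := second_derivative_nonpos (Q.hasFDerivAt_lagrangian z p)
    (hgr.differentiable (by norm_num) z.w).hasFDerivAt h.gradL_eq_zero hu' hle hd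
  have h3 := hpos d hdC hd0
  rw [hessForm, fderiv_lagrangian] at h3
  exact h3.not_ge h2

end ParamMPCC

/-! ### Local minimizers are S-stationary -/

/-- A nonzero functional vanishing on a proper range would be a linear relation among the `c' k`. -/
theorem LinearIndependent.surjective_pi {E κ : Type*} [NormedAddCommGroup E] [NormedSpace ℝ E]
    [Fintype κ] {c' : κ → E →L[ℝ] ℝ} (h : LinearIndependent ℝ c') :
    Function.Surjective (ContinuousLinearMap.pi c') := by
  classical
  change Function.Surjective (ContinuousLinearMap.pi c').toLinearMap
  rw [← LinearMap.range_eq_top]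
  by_contra hne
  obtain ⟨Λ, hΛ, hker⟩ := Submodule.exists_le_ker_of_lt_top _ (lt_top_iff_ne_top.2 hne)
  refine hΛ (LinearMap.pi_ext' fun k => LinearMap.ext_ring ?_)
  refine Fintype.linearIndependent_iff.1 h (fun k => Λ (Pi.single k 1)) ?_ k
  ext x
  have h1 : Λ (ContinuousLinearMap.pi c' x) = 0 := hker ⟨x, rfl⟩
  rw [← LinearMap.sum_single_apply (fun _ : κ => ℝ) (ContinuousLinearMap.pi c' x)] at h1
  rw [zero_apply, ← h1, map_sum, sum_apply]
  refine Finset.sum_congr rfl fun k _ => ?_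
  have h2 : (Pi.single k (c' k x) : κ → ℝ) = c' k x • Pi.single k 1 := by
    rw [← Pi.single_smul', smul_eq_mul, mul_one]
  simp [h2, mul_comm]

/-- First-order necessary conditions for a local minimizer on a set described near the minimizer
by finitely many constraints with linearly independent derivatives. If the minimizer may be
perturbed in the direction in which `s * c k` grows, all other constraints being kept zero, then the
multiplier of `c k` has the sign of `s`. -/
theorem exists_multipliers_of_isLocalMinOn {E κ : Type*} [NormedAddCommGroup E] [NormedSpace ℝ E]
    [FiniteDimensional ℝ E] [Fintype κ] {f : E → ℝ} {f' : E →L[ℝ] ℝ} {c : κ → E → ℝ}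
    {c' : κ → E →L[ℝ] ℝ} {X : Set E} {x : E} (hf : HasStrictFDerivAt f f' x)
    (hc : ∀ k, HasStrictFDerivAt (c k) (c' k) x) (hc0 : ∀ k, c k x = 0)
    (hli : LinearIndependent ℝ c') (hmin : IsLocalMinOn f X x)
    (hX : ∀ᶠ y in 𝓝 x, (∀ k, c k y = 0) → y ∈ X) :
    ∃ a : κ → ℝ, f' = ∑ k, a k • c' k ∧ ∀ k s,
      (∀ᶠ y in 𝓝 x, (∀ j ≠ k, c j y = 0) → 0 ≤ s * c k y → y ∈ X) → 0 ≤ s * a k := by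
  classical
  have hm : ∀ᶠ y in 𝓝 x, y ∈ X → f x ≤ f y := eventually_nhdsWithin_iff.1 hmin
  have hext : IsLocalExtrOn f {y | ∀ k, c k y = c k x} x := by
    refine Or.inl (eventually_nhdsWithin_iff.2 ?_)
    filter_upwards [hm, hX] with y h1 h2 hy
    exact h1 (h2 fun k => (hy k).trans (hc0 k))
  obtain ⟨Λ, Λ₀, hΛ, hsum⟩ := hext.exists_multipliers_of_hasStrictFDerivAt hc hf
  have hΛ₀ : Λ₀ ≠ 0 := by
    rintro rfl
    have h1 : ∑ k, Λ k • c' k = 0 := by simpa using hsum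
    have h2 := Fintype.linearIndependent_iff.1 hli Λ h1
    exact hΛ (Prod.ext (funext h2) rfl)
  have hrep : f' = ∑ k, (-(Λ k / Λ₀)) • c' k := by
    ext y
    have h1 := congrArg (fun T => T y) hsum
    simp only [add_apply, sum_apply, smul_apply, smul_eq_mul, zero_apply] at h1 ⊢
    have h2 : ∑ k, -(Λ k / Λ₀) * c' k y = -(∑ k, Λ k * c' k y) / Λ₀ := by
      rw [neg_div, Finset.sum_div, ← Finset.sum_neg_distrib]
      exact Finset.sum_congr rfl fun k _ => by ring
    rw [h2]
    field_simp
    linarith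
  refine ⟨fun k => -(Λ k / Λ₀), hrep, fun k s hs => ?_⟩
  -- Since `y ↦ c (x + R y)` has identity derivative at `0`, its local inverse `ψ` produces points
  -- near `x` with prescribed constraint values.
  obtain ⟨R, hR⟩ := (ContinuousLinearMap.pi c').exists_rightInverse_of_surjective
    (LinearMap.range_eq_top.2 hli.surjective_pi)
  have hRc : ∀ j (y : κ → ℝ), c' j (R y) = y j := fun j y =>
    congrFun (congrArg (fun T => T y) hR) j
  have hstrict : HasStrictFDerivAt (fun (y : κ → ℝ) j => c j (x + R y))
      ((ContinuousLinearEquiv.refl ℝ (κ → ℝ) : (κ → ℝ) →L[ℝ] (κ → ℝ))) 0 := by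
    rw [hasStrictFDerivAt_pi']
    intro j
    have h1 : HasStrictFDerivAt (fun y : κ → ℝ => x + R y) R 0 :=
      R.hasStrictFDerivAt.const_add x
    have h2 : HasStrictFDerivAt (c j) (c' j) (x + R 0) := by simpa using hc j
    refine (h2.comp (0 : κ → ℝ) h1).congr_fderiv ?_
    ext y
    simp [hRc]
  let ψ := hstrict.localInverse
  have hz : (fun j => c j (x + R 0)) = (0 : κ → ℝ) := by
    funext j
    simp [hc0]
  have hψ0 : ψ 0 = 0 := by
    have := hstrict.localInverse_apply_image
    rwa [hz] at this
  have hψd : HasStrictFDerivAt ψ (ContinuousLinearMap.id ℝ (κ → ℝ)) 0 := by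
    have := hstrict.to_localInverse
    rwa [hz] at this
  have hψr : ∀ᶠ y in 𝓝 (0 : κ → ℝ), ∀ j, c j (x + R (ψ y)) = y j := by
    have := hstrict.eventually_right_inverse
    rw [hz] at this
    exact this.mono fun y hy j => congrFun hy j
  -- Along `t ↦ x + R (ψ (t • e))` the other constraints stay zero and `s * c k` equals `t * s ^ 2`,
  -- so the curve stays in `X` for small `t > 0`. The slope of `f` along it is `s` times the
  -- multiplier.
  let e : κ → ℝ := Pi.single k s
  have hline : HasDerivAt (fun t : ℝ => t • e) e 0 := by
    simpa using (hasDerivAt_id (0 : ℝ)).smul_const e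
  have hγ : HasDerivAt (fun t : ℝ => x + R (ψ (t • e))) (R e) 0 := by
    have h1 : HasDerivAt (fun t : ℝ => ψ (t • e)) e 0 := by
      have h2 : HasFDerivAt ψ (ContinuousLinearMap.id ℝ (κ → ℝ)) ((0 : ℝ) • e) := by
        rw [zero_smul]
        exact hψd.hasFDerivAt
      exact h2.comp_hasDerivAt (0 : ℝ) hline
    exact (R.hasFDerivAt.comp_hasDerivAt (0 : ℝ) h1).const_add x
  have hγ0 : x + R (ψ ((0 : ℝ) • e)) = x := by simp [hψ0]
  have hfγ : HasDerivAt (fun t : ℝ => f (x + R (ψ (t • e)))) (f' (R e)) 0 := by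
    have h2 : HasFDerivAt f f' (x + R (ψ ((0 : ℝ) • e))) := by
      rw [hγ0]
      exact hf.hasFDerivAt
    exact h2.comp_hasDerivAt (0 : ℝ) hγ
  have hval : f' (R e) = s * -(Λ k / Λ₀) := by
    rw [hrep, sum_apply, Finset.sum_eq_single k]
    · simp [hRc, e, mul_comm]
    · intro j _ hj
      simp [hRc, e, hj]
    · simp
  rw [← hval]
  refine ge_of_tendsto hfγ.tendsto_slope_zero_right ?_
  have hγt : Tendsto (fun t : ℝ => x + R (ψ (t • e))) (𝓝[>] 0) (𝓝 x) := by
    have := hγ.continuousAt.tendsto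
    rw [hγ0] at this
    exact this.mono_left nhdsWithin_le_nhds
  have hlt : Tendsto (fun t : ℝ => t • e) (𝓝[>] 0) (𝓝 0) := by
    have := hline.continuousAt.tendsto
    rw [zero_smul] at this
    exact this.mono_left nhdsWithin_le_nhds
  filter_upwards [hγt.eventually hm, hγt.eventually hs, hlt.eventually hψr,
    self_mem_nhdsWithin] with t h1 h2 h3 ht
  replace ht : 0 < t := ht
  have h4 : x + R (ψ (t • e)) ∈ X := by
    refine h2 (fun j hj => ?_) ?_
    · rw [h3]
      simp [e, hj]
    · rw [h3]
      have : s * (t * s) = t * (s * s) := by ring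
      simp only [e, Pi.smul_apply, Pi.single_eq_same, smul_eq_mul, this]
      exact mul_nonneg ht.le (mul_self_nonneg s)
  have h5 := h1 h4
  rw [zero_add, hγ0, smul_eq_mul]
  exact mul_nonneg (inv_nonneg.2 ht.le) (sub_nonneg.2 h5)

namespace ParamMPCC

variable {n np mh mg m : ℕ} {Q : ParamMPCC n np mh mg m}

/-- Near a feasible point only the constraints vanishing there matter for feasibility. -/
theorem Feasible.eventually_feasible {w : Vec n} {p : Vec np} (hf : Q.Feasible w p) :
    ∀ᶠ a in 𝓝 (w, p), (∀ i, Q.h i a = 0) → (∀ i, Q.g i (w, p) = 0 → Q.g i a ≤ 0) →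
      (∀ i, Q.G i (w, p) = 0 → 0 ≤ Q.G i a) → (∀ i, Q.H i (w, p) = 0 → 0 ≤ Q.H i a) →
      (∀ i, Q.G i a = 0 ∨ Q.H i a = 0) → Q.Feasible a.1 a.2 := by
  have e1 : ∀ᶠ a in 𝓝 (w, p), ∀ i, Q.g i (w, p) < 0 → Q.g i a < 0 :=
    eventually_all.2 fun i => eventually_imp_distrib_left.2 fun h =>
      ((Q.contDiff_g i).continuous.tendsto _).eventually_lt_const h
  have e2 : ∀ᶠ a in 𝓝 (w, p), ∀ i, 0 < Q.G i (w, p) → 0 < Q.G i a :=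
    eventually_all.2 fun i => eventually_imp_distrib_left.2 fun h =>
      ((Q.contDiff_G i).continuous.tendsto _).eventually_const_lt h
  have e3 : ∀ᶠ a in 𝓝 (w, p), ∀ i, 0 < Q.H i (w, p) → 0 < Q.H i a :=
    eventually_all.2 fun i => eventually_imp_distrib_left.2 fun h =>
      ((Q.contDiff_H i).continuous.tendsto _).eventually_const_lt h
  filter_upwards [e1, e2, e3] with a h1 h2 h3 hh hg hG hH hGH
  refine ⟨hh, fun i => ?_, fun i => ⟨?_, ?_, mul_eq_zero.2 (hGH i)⟩⟩
  · exact (hf.2.1 i).eq_or_lt.elim (hg i) fun h => (h1 i h).le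
  · exact (hf.2.2 i).1.eq_or_lt.elim (fun h => hG i h.symm) fun h => (h2 i h).le
  · exact (hf.2.2 i).2.1.eq_or_lt.elim (fun h => hH i h.symm) fun h => (h3 i h).le

/-- A local minimizer of the MPCC with linearly independent gradients is S-stationary. -/
theorem exists_sStationary_of_isLocalMinOn {w : Vec n} {p : Vec np} (hf : Q.Feasible w p)
    (hv : Q.VanishingIndependent w p)
    (hmin : IsLocalMinOn (fun x => Q.f (x, p)) {x | Q.Feasible x p} w) :
    ∃ z : PrimalDual n mh mg m, z.w = w ∧ Q.SStationary z p := by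
  classical
  have hnear := ((by fun_prop : Continuous fun x : Vec n => (x, p)).tendsto w).eventually
    hf.eventually_feasible
  have hGH : ∀ i, Q.G i (w, p) = 0 ∨ Q.H i (w, p) = 0 := fun i => mul_eq_zero.1 (hf.2.2 i).2.2
  obtain ⟨a, ha, hsign⟩ := exists_multipliers_of_isLocalMinOn
    (c := fun (k : Q.vanishing w p) x => Q.con k (x, p))
    (hasStrictFDerivAt_dw Q.contDiff_f w p)
    (fun k => hasStrictFDerivAt_dw (Q.contDiff_con k) w p) (fun k => k.2) hv hmin (by
      filter_upwards [hnear] with x hx h0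
      exact hx (fun i => h0 ⟨.inl i, hf.1 i⟩) (fun i hi => (h0 ⟨.inr (.inl i), hi⟩).le)
        (fun i hi => (h0 ⟨.inr (.inr (.inl i)), hi⟩).ge)
        (fun i hi => (h0 ⟨.inr (.inr (.inr i)), hi⟩).ge)
        (fun i => (hGH i).imp (fun hi => h0 ⟨.inr (.inr (.inl i)), hi⟩)
          (fun hi => h0 ⟨.inr (.inr (.inr i)), hi⟩)))
  -- The sign changes because `gradL` carries the multipliers on the same side as the gradient of
  -- `f`.
  let y : ConIdx mh mg m → ℝ := fun k => if hk : k ∈ Q.vanishing w p then -a ⟨k, hk⟩ else 0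
  have hy0 : ∀ k, Q.con k (w, p) ≠ 0 → y k = 0 := fun k hk => dif_neg hk
  have hy1 : ∀ k (hk : k ∈ Q.vanishing w p), y k = -a ⟨k, hk⟩ := fun k hk => dif_pos hk
  have hgrad : Q.gradL w y p = 0 := by
    have h1 : ∑ k, y k • dw (Q.con k) w p =
        ∑ k : Q.vanishing w p, -(a k • dw (Q.con k) w p) := by
      symm
      refine Finset.sum_of_injOn Subtype.val Subtype.val_injective.injOn (by simp)
        (fun k _ hk => ?_) (fun k _ => ?_)
      · have hk' : Q.con k (w, p) ≠ 0 := fun h => hk ⟨⟨k, h⟩, by simp, rfl⟩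
        rw [hy0 k hk']
        exact zero_smul ℝ _
      · rw [hy1 k k.2]
        ext d
        simp
    rw [gradL, h1, ha, Finset.sum_neg_distrib, add_neg_cancel]
  have hsign' : ∀ k (hk : Q.con k (w, p) = 0) s, (∀ᶠ x in 𝓝 w,
      (∀ j, Q.con j (w, p) = 0 → j ≠ k → Q.con j (x, p) = 0) → 0 ≤ s * Q.con k (x, p) →
        Q.Feasible x p) → 0 ≤ s * a ⟨k, hk⟩ := fun k hk s h =>
    hsign ⟨k, hk⟩ s (h.mono fun x hx h0 => hx fun j hj hjk =>
      h0 ⟨j, hj⟩ fun h => hjk (congrArg Subtype.val h))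
  refine ⟨PrimalDual.ofMult (w, y), rfl, hf, ?_, fun i => ⟨?_, ?_⟩, fun i hi => ?_, fun i hi => ?_,
    fun i hi => ⟨?_, ?_⟩⟩
  · rw [fderiv_lagrangian, PrimalDual.mult_ofMult]
    exact hgrad
  · change 0 ≤ y (.inr (.inl i))
    by_cases hi : Q.con (.inr (.inl i)) (w, p) = 0
    · rw [hy1 _ hi]
      have h1 := hsign' (.inr (.inl i)) hi (-1) (by
        filter_upwards [hnear] with x hx h0 hs
        have hs' : Q.g i (x, p) ≤ 0 := by
          have : 0 ≤ -1 * Q.g i (x, p) := hs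
          linarith
        refine hx (fun j => h0 (.inl j) (hf.1 j) (by simp)) (fun j hj => ?_)
          (fun j hj => (h0 (.inr (.inr (.inl j))) hj (by simp)).ge)
          (fun j hj => (h0 (.inr (.inr (.inr j))) hj (by simp)).ge)
          (fun j => (hGH j).imp (fun hj => h0 (.inr (.inr (.inl j))) hj (by simp))
            (fun hj => h0 (.inr (.inr (.inr j))) hj (by simp)))
        by_cases hji : j = i
        · exact hji ▸ hs'
        · exact (h0 (.inr (.inl j)) hj (by simp [hji])).le)
      linarith
    · exact (hy0 _ hi).ge
  · change y (.inr (.inl i)) * Q.con (.inr (.inl i)) (w, p) = 0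
    by_cases hi : Q.con (.inr (.inl i)) (w, p) = 0
    · rw [hi, mul_zero]
    · rw [hy0 _ hi, zero_mul]
  · change -y (.inr (.inr (.inr i))) = 0
    rw [hy0 (.inr (.inr (.inr i))) hi.2.ne', neg_zero]
  · change -y (.inr (.inr (.inl i))) = 0
    rw [hy0 (.inr (.inr (.inl i))) hi.1.ne', neg_zero]
  · change 0 ≤ -y (.inr (.inr (.inl i)))
    rw [hy1 _ hi.1, neg_neg]
    -- Letting `G i` grow with `H i` kept at zero preserves feasibility.
    have h1 := hsign' (.inr (.inr (.inl i))) hi.1 1 (by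
      filter_upwards [hnear] with x hx h0 hs
      have hs' : 0 ≤ Q.G i (x, p) := by
        have : 0 ≤ 1 * Q.G i (x, p) := hs
        linarith
      refine hx (fun j => h0 (.inl j) (hf.1 j) (by simp))
        (fun j hj => (h0 (.inr (.inl j)) hj (by simp)).le) (fun j hj => ?_)
        (fun j hj => (h0 (.inr (.inr (.inr j))) hj (by simp)).ge) (fun j => ?_)
      · by_cases hji : j = i
        · exact hji ▸ hs'
        · exact (h0 (.inr (.inr (.inl j))) hj (by simp [hji])).ge
      · by_cases hji : j = i
        · exact Or.inr (h0 (.inr (.inr (.inr j))) (hji ▸ hi.2) (by simp))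
        · exact (hGH j).imp (fun hj => h0 (.inr (.inr (.inl j))) hj (by simp [hji]))
            (fun hj => h0 (.inr (.inr (.inr j))) hj (by simp)))
    linarith
  · change 0 ≤ -y (.inr (.inr (.inr i)))
    rw [hy1 _ hi.2, neg_neg]
    have h1 := hsign' (.inr (.inr (.inr i))) hi.2 1 (by
      filter_upwards [hnear] with x hx h0 hs
      have hs' : 0 ≤ Q.H i (x, p) := by
        have : 0 ≤ 1 * Q.H i (x, p) := hs
        linarith
      refine hx (fun j => h0 (.inl j) (hf.1 j) (by simp))
        (fun j hj => (h0 (.inr (.inl j)) hj (by simp)).le)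
        (fun j hj => (h0 (.inr (.inr (.inl j))) hj (by simp)).ge) (fun j hj => ?_) (fun j => ?_)
      · by_cases hji : j = i
        · exact hji ▸ hs'
        · exact (h0 (.inr (.inr (.inr j))) hj (by simp [hji])).ge
      · by_cases hji : j = i
        · exact Or.inl (h0 (.inr (.inr (.inl j))) (hji ▸ hi.1) (by simp))
        · exact (hGH j).imp (fun hj => h0 (.inr (.inr (.inl j))) hj (by simp))
            (fun hj => h0 (.inr (.inr (.inr j))) hj (by simp [hji])))
    linarith

end ParamMPCC

/-! ### Persistence of S-stationary points -/

namespace ParamMPCC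

variable {n np mh mg m : ℕ} {Q : ParamMPCC n np mh mg m}

/-- Independence is an open condition, and no further constraint vanishes nearby, so the family can
only shrink. -/
theorem VanishingIndependent.eventually {w : Vec n} {p : Vec np}
    (h : Q.VanishingIndependent w p) : ∀ᶠ a in 𝓝 (w, p), Q.VanishingIndependent a.1 a.2 := by
  have h1 : Tendsto (fun (a : Vec n × Vec np) (k : Q.vanishing w p) => dw (Q.con k) a.1 a.2)
      (𝓝 (w, p)) (𝓝 fun k => dw (Q.con k) w p) :=
    tendsto_pi_nhds.2 fun k => (contDiff_dw (Q.contDiff_con k)).continuous.tendsto (w, p)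
  have h2 : ∀ᶠ a in 𝓝 (w, p), ∀ k, Q.con k (w, p) ≠ 0 → Q.con k a ≠ 0 :=
    eventually_all.2 fun k => eventually_imp_distrib_left.2 fun h =>
      ((Q.continuous_con k).tendsto _).eventually_ne h
  filter_upwards [h1.eventually (LinearIndependent.eventually h), h2] with a ha hne
  have hsub : Q.vanishing a.1 a.2 ⊆ Q.vanishing w p := fun k hk => by
    by_contra h
    exact hne k h hk
  exact LinearIndependent.comp ha (inclusion hsub) (inclusion_injective hsub)

/-- Under linear independence of the gradients, feasible points persist under perturbations of the
parameter. -/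
theorem VanishingIndependent.eventually_exists_feasible {w : Vec n} {p : Vec np}
    (h : Q.VanishingIndependent w p) (hf : Q.Feasible w p) {N : Set (Vec n × Vec np)}
    (hN : N ∈ 𝓝 (w, p)) : ∀ᶠ q in 𝓝 p, ∃ x, (x, q) ∈ N ∧ Q.Feasible x q := by
  classical
  let c' : Vec n × Vec np →L[ℝ] (Q.vanishing w p → ℝ) :=
    ContinuousLinearMap.pi fun k => fderiv ℝ (Q.con k) (w, p)
  have hΦ : HasStrictFDerivAt (fun a : Vec n × Vec np => (fun k : Q.vanishing w p => Q.con k a, a.2))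
      (c'.prod (ContinuousLinearMap.snd ℝ (Vec n) (Vec np))) (w, p) := by
    refine HasStrictFDerivAt.prodMk (hasStrictFDerivAt_pi.2 fun k => ?_) hasStrictFDerivAt_snd
    exact (Q.contDiff_con k).contDiffAt.hasStrictFDerivAt (by norm_num)
  have hsurj : (c'.prod (ContinuousLinearMap.snd ℝ (Vec n) (Vec np))).range = ⊤ := by
    refine LinearMap.range_eq_top.2 ?_
    rintro ⟨y, q⟩
    -- The direction `d` compensates for the effect of the parameter shift `q` on the constraints.
    obtain ⟨d, hd⟩ := LinearIndependent.surjective_pi h (y - c' (0, q))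
    refine ⟨(d, q), Prod.ext ?_ rfl⟩
    have h1 : c' (d, 0) = y - c' (0, q) := by
      rw [← hd]
      funext k
      simp [c', dw_eq (Q.contDiff_con k)]
    have h2 : ((d, q) : Vec n × Vec np) = (d, 0) + (0, q) := by simp
    change c' (d, q) = y
    rw [h2, map_add, h1, sub_add_cancel]
  -- A submersion is open, so for `q` near `p` some point near `w` keeps all the vanishing
  -- constraints at zero.
  have hmap := hΦ.map_nhds_eq_of_surj hsurj
  have h0 : (fun k : Q.vanishing w p => Q.con k (w, p)) = 0 := funext fun k => k.2
  simp only [h0] at hmap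
  have himg := image_mem_map (m := fun a : Vec n × Vec np =>
    (fun k : Q.vanishing w p => Q.con k a, a.2)) (inter_mem hN hf.eventually_feasible)
  rw [hmap] at himg
  have hq : Tendsto (fun q : Vec np => ((0 : Q.vanishing w p → ℝ), q)) (𝓝 p) (𝓝 (0, p)) :=
    (by fun_prop : Continuous fun q : Vec np => ((0 : Q.vanishing w p → ℝ), q)).tendsto p
  filter_upwards [hq himg] with q hq
  obtain ⟨⟨x, q'⟩, ⟨hxN, hx⟩, hx'⟩ := hq
  obtain ⟨hx0, rfl⟩ := Prod.ext_iff.1 hx'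
  have h1 : ∀ k, Q.con k (w, p) = 0 → Q.con k (x, q') = 0 := fun k hk => congrFun hx0 ⟨k, hk⟩
  refine ⟨x, hxN, hx (fun i => h1 (.inl i) (hf.1 i)) (fun i hi => (h1 (.inr (.inl i)) hi).le)
    (fun i hi => (h1 (.inr (.inr (.inl i))) hi).ge)
    (fun i hi => (h1 (.inr (.inr (.inr i))) hi).ge) fun i => ?_⟩
  exact (mul_eq_zero.1 (hf.2.2 i).2.2).imp (h1 (.inr (.inr (.inl i))))
    (h1 (.inr (.inr (.inr i))))

theorem isClosed_feasible : IsClosed {a : Vec n × Vec np | Q.Feasible a.1 a.2} := by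
  have hh := fun i => (Q.contDiff_h i).continuous
  have hg := fun i => (Q.contDiff_g i).continuous
  have hG := fun i => (Q.contDiff_G i).continuous
  have hH := fun i => (Q.contDiff_H i).continuous
  have : {a : Vec n × Vec np | Q.Feasible a.1 a.2} = (⋂ i, {a | Q.h i a = 0}) ∩
      ((⋂ i, {a | Q.g i a ≤ 0}) ∩ ⋂ i, ({a | 0 ≤ Q.G i a} ∩ ({a | 0 ≤ Q.H i a} ∩
        {a | Q.G i a * Q.H i a = 0}))) := by
    ext a
    simp [Feasible]
  rw [this]
  exact (isClosed_iInter fun i => isClosed_eq (hh i) continuous_const).inter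
    ((isClosed_iInter fun i => isClosed_le (hg i) continuous_const).inter
      (isClosed_iInter fun i => (isClosed_le continuous_const (hG i)).inter
        ((isClosed_le continuous_const (hH i)).inter
          (isClosed_eq ((hG i).mul (hH i)) continuous_const))))

/-- An S-stationary point satisfying the strong second-order condition and linear independence of
the gradients persists under perturbations of the parameter. -/
theorem SStationary.eventually_exists {z : PrimalDual n mh mg m} {p : Vec np}
    (h : Q.SStationary z p) (hv : Q.VanishingIndependent z.w p)
    (hpos : ∀ d ∈ Q.strongMPCCCone z p, d ≠ 0 → 0 < Q.hessForm z p d) :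
    ∀ᶠ q in 𝓝 p, ∃ z' : PrimalDual n mh mg m, Q.SStationary z' q := by
  have hfc : Continuous Q.f := Q.contDiff_f.continuous
  have hcl := isClosed_feasible (Q := Q)
  have hcl' : ∀ q, IsClosed {x | Q.Feasible x q} := fun q =>
    hcl.preimage (by fun_prop : Continuous fun x : Vec n => (x, q))
  obtain ⟨V, hV, W, hW, hVW⟩ := mem_nhds_prod_iff.1 hv.eventually
  obtain ⟨r, hr, hball⟩ := Metric.nhds_basis_closedBall.mem_iff.1
    (inter_mem hV (h.eventually_lt hpos))
  -- By strict minimality and compactness, `α` separates the central value from the feasible values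
  -- on the sphere. If the sphere has no feasible point, any larger number works.
  obtain ⟨α, hα, hsph⟩ : ∃ α, Q.f (z.w, p) < α ∧
      ∀ x ∈ Metric.sphere z.w r, Q.Feasible x p → α < Q.f (x, p) := by
    rcases (Metric.sphere z.w r ∩ {x | Q.Feasible x p}).eq_empty_or_nonempty with he | hne
    · exact ⟨Q.f (z.w, p) + 1, by linarith, fun x hx hxf =>
        absurd (show x ∈ Metric.sphere z.w r ∩ {x | Q.Feasible x p} from ⟨hx, hxf⟩) (by simp [he])⟩
    · obtain ⟨x, hx, hxmin⟩ := ((isCompact_sphere z.w r).inter_right (hcl' p)).exists_isMinOn hne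
        (f := fun x => Q.f (x, p)) (by fun_prop)
      have hlt : Q.f (z.w, p) < Q.f (x, p) :=
        (hball (Metric.sphere_subset_closedBall hx.1)).2 hx.2 (Metric.ne_of_mem_sphere hx.1 hr.ne')
      obtain ⟨α, h1, h2⟩ := exists_between hlt
      exact ⟨α, h1, fun y hy hyf => h2.trans_le (hxmin ⟨hy, hyf⟩)⟩
  -- By compactness the gap need only persist locally: by continuity of `f` near feasible points,
  -- and because infeasibility is open near the others.
  have hsph' : ∀ᶠ q in 𝓝 p, ∀ x ∈ Metric.sphere z.w r, Q.Feasible x q → α < Q.f (x, q) := by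
    refine (isCompact_sphere z.w r).eventually_forall_of_forall_eventually fun x hx => ?_
    have : ∀ᶠ a in 𝓝 (x, p), Q.Feasible a.1 a.2 → α < Q.f a := by
      by_cases hxf : Q.Feasible x p
      · filter_upwards [(hfc.tendsto (x, p)).eventually_const_lt (hsph x hx hxf)] with a ha _
        exact ha
      · filter_upwards [hcl.isOpen_compl.mem_nhds hxf] with a ha haf
        exact absurd haf ha
    exact ((by fun_prop : Continuous fun a : Vec np × Vec n => (a.2, a.1)).tendsto
      (p, x)).eventually this
  have hN : {a : Vec n × Vec np | Q.f a < α ∧ a.1 ∈ Metric.closedBall z.w r} ∈ 𝓝 (z.w, p) :=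
    ((hfc.tendsto (z.w, p)).eventually_lt_const hα).and
      (continuousAt_fst.eventually (Metric.closedBall_mem_nhds z.w hr))
  filter_upwards [hsph', hv.eventually_exists_feasible h.1 hN, hW] with q hq1 ⟨x, hxN, hxf⟩ hqW
  obtain ⟨y, hy, hymin⟩ := ((isCompact_closedBall z.w r).inter_right (hcl' q)).exists_isMinOn
    ⟨x, hxN.2, hxf⟩ (f := fun x => Q.f (x, q)) (by fun_prop)
  have hyα : Q.f (y, q) < α := (hymin (a := x) ⟨hxN.2, hxf⟩).trans_lt hxN.1
  -- The minimal value is below `α`, which excludes the sphere; an interior minimizer is a local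
  -- minimizer of the MPCC.
  have hyball : y ∈ Metric.ball z.w r := by
    refine Metric.mem_ball.2 (lt_of_le_of_ne (Metric.mem_closedBall.1 hy.1) fun he => ?_)
    exact (hq1 y (Metric.mem_sphere.2 he) hy.2).not_gt hyα
  have hmin : IsLocalMinOn (fun x => Q.f (x, q)) {x | Q.Feasible x q} y := by
    refine eventually_nhdsWithin_iff.2 ?_
    filter_upwards [Metric.isOpen_ball.mem_nhds hyball] with x hx hxf
    exact hymin ⟨Metric.ball_subset_closedBall hx, hxf⟩
  obtain ⟨z', -, hz'⟩ := exists_sStationary_of_isLocalMinOn hy.2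
    (hVW (show (y, q) ∈ V ×ˢ W from ⟨(hball hy.1).1, hqW⟩)) hmin
  exact ⟨z', hz'⟩

end ParamMPCC

/-! ### The switching theorem -/

theorem eventually_forall_Icc_of_eventually {P : ℝ → Prop} {a : ℝ} (h : ∀ᶠ t in 𝓝 a, P t) :
    ∀ᶠ b in 𝓝[>] a, ∀ t ∈ Set.Icc a b, P t := by
  obtain ⟨ε, hε, hP⟩ := Metric.eventually_nhds_iff.1 h
  filter_upwards [Ioo_mem_nhdsGT (lt_add_of_pos_right a hε)] with b hb t ht
  refine hP ?_
  rw [Real.dist_eq, abs_of_nonneg (sub_nonneg.2 ht.1)]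
  linarith [ht.2, hb.2]

theorem mainTheorem2 {n np mh mg m : ℕ} (Q : ParamMPCC n np mh mg m)
    (wbar : Vec n) (pbar : Vec np)
    (hB : Q.BStationary wbar pbar) (hLICQ : Q.MPCCLICQ wbar pbar)
    (hSSOSC : Q.MPCCSSOSC wbar pbar)
    -- the branch solution map, on a neighborhood that contains the parameter segment
    (v : Vec np) (I : Set (Fin m)) (hI : I ∈ Q.branches wbar pbar)
    (U : Set (Vec np)) (hU : IsOpen U) (hSU : paramSegment pbar v 1 ⊆ U)
    (zI : Vec np → PrimalDual n mh mg m) (hzI : Q.BranchSolutionMap I U zI)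
    (hzbar : (zI pbar).w = wbar)
    -- the switching index, its multiplier, and the switching parameter
    (i : Fin m) (θ : Vec np → ℝ)
    (hθ : (i ∈ Q.I0p wbar pbar ∧ θ = fun p => (zI p).xi i) ∨
      (i ∈ Q.Ip0 wbar pbar ∧ θ = fun p => (zI p).nu i))
    (τs : ℝ) (hτs : τs ∈ Set.Ioo (0 : ℝ) 1)
    (hbefore : ∀ τ ∈ Set.Ico 0 τs, i ∉ Q.I00 (zI (pbar + τ • v)).w (pbar + τ • v))
    (hafter : ∀ τ ∈ Set.Icc τs 1, i ∈ Q.I00 (zI (pbar + τ • v)).w (pbar + τ • v)) :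
    -- (a)
    (Q.OtherPairsSigned i (paramSegment pbar v 1) zI →
      (∀ τ ∈ Set.Icc τs 1, 0 ≤ θ (pbar + τ • v)) →
        ∀ p ∈ paramSegment pbar v 1, PC1At zI p ∧ Q.BStationary (zI p).w p) ∧
    -- (b)
    (θ (pbar + τs • v) < 0 →
      (∀ τ ∈ Set.Icc τs 1, θ (pbar + τ • v) < 0 →
        ¬ Q.BStationary (zI (pbar + τ • v)).w (pbar + τ • v)) ∧
      (∀ᶠ T in 𝓝[>] τs, ∀ τ ∈ Set.Icc τs T,
        ¬ Q.BStationary (zI (pbar + τ • v)).w (pbar + τ • v)) ∧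
      (Q.OtherPairsSigned i ((fun τ : ℝ => pbar + τ • v) '' Set.Ico 0 τs) zI →
        ∀ what : Vec n, Q.BStationary what (pbar + τs • v) →
          Q.MPCCLICQ what (pbar + τs • v) → Q.MPCCSSOSC what (pbar + τs • v) →
          ∀ᶠ T in 𝓝[>] τs, ∃ z : Vec np → PrimalDual n mh mg m,
            (∀ p ∈ paramSegment pbar v T, Q.BStationary (z p).w p ∧ Q.SStationary (z p) p) ∧
            (∀ τ ∈ Set.Ico 0 τs, z (pbar + τ • v) = zI (pbar + τ • v)) ∧
            (z (pbar + τs • v)).w = what ∧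
            ¬ ContinuousWithinAt z (paramSegment pbar v T) (pbar + τs • v) ∧
            ¬ ContinuousWithinAt (fun p => (z p).w) (paramSegment pbar v T)
              (pbar + τs • v))) ∧
    -- exactly one of the two alternatives
    (Q.OtherPairsSigned i (paramSegment pbar v 1) zI → θ (pbar + τs • v) ≠ 0 →
      ∀ᶠ T in 𝓝[>] τs,
        Xor (∀ p ∈ paramSegment pbar v T, PC1At zI p ∧ Q.BStationary (zI p).w p)
          (∀ τ ∈ Set.Icc τs T,
            ¬ Q.BStationary (zI (pbar + τ • v)).w (pbar + τ • v))) := by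
  have hmem : ∀ τ ∈ Set.Icc (0 : ℝ) 1, pbar + τ • v ∈ U := fun τ hτ => hSU ⟨τ, hτ, rfl⟩
  have hs01 : τs ∈ Set.Icc (0 : ℝ) 1 := ⟨hτs.1.le, hτs.2.le⟩
  have hv0 : v ≠ 0 := by
    rintro rfl
    have h1 := hbefore 0 ⟨le_rfl, hτs.1⟩
    have h2 := hafter τs ⟨le_rfl, hτs.2.le⟩
    simp only [smul_zero] at h1 h2
    exact h1 h2
  have hinj : ∀ τ τ' : ℝ, pbar + τ • v = pbar + τ' • v → τ = τ' := fun τ τ' h =>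
    smul_left_injective ℝ hv0 (add_left_cancel h)
  have hline : Continuous fun τ : ℝ => pbar + τ • v := by fun_prop
  have hzc : ContinuousAt zI (pbar + τs • v) := hzI.1.continuousAt (hU.mem_nhds (hmem τs hs01))
  -- In both cases `θ` belongs to the equality constraint of the pair `i`, the one multiplier of the
  -- pair that branch `I` leaves unsigned.
  have hiI : (i ∈ I ∧ θ = fun p => (zI p).xi i) ∨ (i ∉ I ∧ θ = fun p => (zI p).nu i) := by
    rcases hθ with ⟨hi, h⟩ | ⟨hi, h⟩
    · refine Or.inl ⟨?_, h⟩
      by_contra hiI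
      exact hi.2.ne' (ParamMPCC.branches_H hB.1 hI hiI)
    · exact Or.inr ⟨fun hiI => hi.1.ne' (ParamMPCC.branches_G hI hiI), h⟩
  have hθc : ContinuousAt θ (pbar + τs • v) := by
    rcases hiI with ⟨-, rfl⟩ | ⟨-, rfl⟩
    · have hc : Continuous fun z : PrimalDual n mh mg m => z.xi i := by
        unfold PrimalDual.xi
        fun_prop
      exact hc.continuousAt.comp hzc
    · have hc : Continuous fun z : PrimalDual n mh mg m => z.nu i := by
        unfold PrimalDual.nu
        fun_prop
      exact hc.continuousAt.comp hzc
  have hθl : Tendsto (fun τ : ℝ => θ (pbar + τ • v)) (𝓝 τs) (𝓝 (θ (pbar + τs • v))) :=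
    hθc.tendsto.comp (hline.tendsto τs)
  have hstat : ∀ p ∈ U, (∀ j ∈ Q.I00 (zI p).w p, j ≠ i → 0 ≤ (zI p).xi j ∧ 0 ≤ (zI p).nu j) →
      (i ∈ Q.I00 (zI p).w p → 0 ≤ θ p) → Q.SStationary (zI p) p := by
    intro p hp ho hi
    have hK := (hzI.2 p hp).1
    refine hK.sStationary fun j hj => ?_
    by_cases hji : j = i
    · subst hji
      have hθj := hi hj
      rcases hiI with ⟨hjI, rfl⟩ | ⟨hjI, rfl⟩
      · exact ⟨hθj, (hK.2.2.2.1 j hjI).2.2.1⟩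
      · exact ⟨(hK.2.2.2.2 j hjI).2.2.1, hθj⟩
    · exact ho j hj hji
  have hnot : ∀ τ ∈ Set.Icc τs 1, θ (pbar + τ • v) < 0 →
      ¬ Q.BStationary (zI (pbar + τ • v)).w (pbar + τ • v) := by
    intro τ hτ hneg hBs
    obtain ⟨hK, hL, -⟩ := hzI.2 _ (hmem τ ⟨hτs.1.le.trans hτ.1, hτ.2⟩)
    have h1 := hK.nonneg_of_bStationary hL.vanishingIndependent hBs (hafter τ hτ)
    rcases hiI with ⟨-, rfl⟩ | ⟨-, rfl⟩
    exacts [hneg.not_ge h1.1, hneg.not_ge h1.2]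
  have hT1 : ∀ᶠ T in 𝓝[>] τs, T ≤ 1 := by
    filter_upwards [Ioc_mem_nhdsGT hτs.2] with T hT
    exact hT.2
  have hnotT : θ (pbar + τs • v) < 0 → ∀ᶠ T in 𝓝[>] τs, ∀ τ ∈ Set.Icc τs T,
      ¬ Q.BStationary (zI (pbar + τ • v)).w (pbar + τ • v) := by
    intro hneg
    filter_upwards [hT1, eventually_forall_Icc_of_eventually (hθl.eventually_lt_const hneg)]
      with T hT hlt τ hτ
    exact hnot τ ⟨hτ.1, hτ.2.trans hT⟩ (hlt τ hτ)
  have hgood : ∀ T ≤ 1, Q.OtherPairsSigned i (paramSegment pbar v 1) zI →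
      (∀ τ ∈ Set.Icc τs T, 0 ≤ θ (pbar + τ • v)) →
        ∀ p ∈ paramSegment pbar v T, PC1At zI p ∧ Q.BStationary (zI p).w p := by
    rintro T hT ho hnn _ ⟨τ, hτ, rfl⟩
    have hτ1 : τ ∈ Set.Icc (0 : ℝ) 1 := ⟨hτ.1, hτ.2.trans hT⟩
    refine ⟨hzI.pc1At hU (hmem τ hτ1),
      (hstat _ (hmem τ hτ1) (ho _ ⟨τ, hτ1, rfl⟩) fun hi => ?_).bStationary⟩
    refine hnn τ ⟨?_, hτ.2⟩
    by_contra h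
    exact hbefore τ ⟨hτ.1, not_le.1 h⟩ hi
  refine ⟨hgood 1 le_rfl, fun hneg => ⟨hnot, hnotT hneg, ?_⟩, ?_⟩
  · intro ho what hBw hLw hSw
    obtain ⟨zhat, hzw, hzS, hzpos⟩ := hSw
    have hnotB := hnot τs ⟨le_rfl, hτs.2.le⟩ hneg
    have hev := hzS.eventually_exists (hzw ▸ hLw.vanishingIndependent hBw.1) hzpos
    filter_upwards [eventually_forall_Icc_of_eventually ((hline.tendsto τs).eventually hev),
      self_mem_nhdsWithin] with T hex hTs
    -- After `τs` only S-stationarity is required, so `z` can be chosen separately at each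
    -- parameter. Off the segment `zhat` is a default value.
    have hz : ∀ p, ∃ z : PrimalDual n mh mg m,
        (p ∈ (fun τ : ℝ => pbar + τ • v) '' Set.Ico 0 τs → z = zI p) ∧
        (p = pbar + τs • v → z = zhat) ∧ (p ∈ paramSegment pbar v T → Q.SStationary z p) := by
      intro p
      by_cases hp : p ∈ (fun τ : ℝ => pbar + τ • v) '' Set.Ico 0 τs
      · obtain ⟨τ, hτ, rfl⟩ := hp
        refine ⟨zI (pbar + τ • v), fun _ => rfl, fun h => absurd (hinj _ _ h) hτ.2.ne, fun _ => ?_⟩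
        exact hstat _ (hmem τ ⟨hτ.1, hτ.2.le.trans hτs.2.le⟩) (ho _ ⟨τ, hτ, rfl⟩)
          fun hi => absurd hi (hbefore τ hτ)
      · by_cases hps : p = pbar + τs • v
        · exact ⟨zhat, fun h => absurd h hp, fun _ => rfl, fun _ => hps ▸ hzS⟩
        · by_cases hpT : p ∈ paramSegment pbar v T
          · obtain ⟨τ, hτ, rfl⟩ := hpT
            obtain ⟨z', hz'⟩ := hex τ ⟨not_lt.1 fun h => hp ⟨τ, ⟨hτ.1, h⟩, rfl⟩, hτ.2⟩
            exact ⟨z', fun h => absurd h hp, fun h => absurd h hps, fun _ => hz'⟩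
          · exact ⟨zhat, fun h => absurd h hp, fun h => absurd h hps, fun h => absurd h hpT⟩
    choose z hz1 hz2 hz3 using hz
    -- Continuity would identify `what` with the left limit of the branch solution, but only one of
    -- these is B-stationary.
    have hdisc : ¬ ContinuousWithinAt (fun p => (z p).w) (paramSegment pbar v T)
        (pbar + τs • v) := by
      intro hc
      have hin : Tendsto (fun τ : ℝ => pbar + τ • v) (𝓝[<] τs)
          (𝓝[paramSegment pbar v T] (pbar + τs • v)) := by
        refine tendsto_nhdsWithin_iff.2 ⟨(hline.tendsto τs).mono_left nhdsWithin_le_nhds, ?_⟩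
        filter_upwards [Ico_mem_nhdsLT hτs.1] with τ hτ
        exact ⟨τ, ⟨hτ.1, hτ.2.le.trans (le_of_lt hTs)⟩, rfl⟩
      have h1 : Tendsto (fun τ : ℝ => (z (pbar + τ • v)).w) (𝓝[<] τs)
          (𝓝 (z (pbar + τs • v)).w) := hc.tendsto.comp hin
      have h2 : Tendsto (fun τ : ℝ => (zI (pbar + τ • v)).w) (𝓝[<] τs)
          (𝓝 (zI (pbar + τs • v)).w) :=
        ((PrimalDual.continuous_w.tendsto _).comp hzc.tendsto).comp
          ((hline.tendsto τs).mono_left nhdsWithin_le_nhds)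
      have h3 : (z (pbar + τs • v)).w = (zI (pbar + τs • v)).w := by
        refine tendsto_nhds_unique h1 (h2.congr' ?_)
        filter_upwards [Ico_mem_nhdsLT hτs.1] with τ hτ
        rw [hz1 _ ⟨τ, hτ, rfl⟩]
      rw [hz2 _ rfl, hzw] at h3
      exact hnotB (h3 ▸ hBw)
    exact ⟨z, fun p hp => ⟨(hz3 p hp).bStationary, hz3 p hp⟩,
      fun τ hτ => hz1 _ ⟨τ, hτ, rfl⟩, by rw [hz2 _ rfl, hzw],
      fun hc => hdisc (PrimalDual.continuous_w.continuousAt.comp_continuousWithinAt hc), hdisc⟩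
  · intro ho hne
    rcases hne.lt_or_gt with hneg | hpos
    · filter_upwards [hnotT hneg, self_mem_nhdsWithin] with T hT hTs
      replace hTs : τs < T := hTs
      exact Or.inr ⟨hT, fun h => hT τs ⟨le_rfl, hTs.le⟩ (h _ ⟨τs, ⟨hτs.1.le, hTs.le⟩, rfl⟩).2⟩
    · filter_upwards [hT1, eventually_forall_Icc_of_eventually (hθl.eventually_const_lt hpos),
        self_mem_nhdsWithin] with T hT hlt hTs
      replace hTs : τs < T := hTs
      have hg := hgood T hT ho fun τ hτ => (hlt τ hτ).le
      exact Or.inl ⟨hg, fun h => h τs ⟨le_rfl, hTs.le⟩ (hg _ ⟨τs, ⟨hτs.1.le, hTs.le⟩, rfl⟩).2⟩
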